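/- Let $T^2=\mathbb R^2/\mathbb Z^2$ with coordinates $(x,y)$. A vector field $\partial_y+h\,\partial_x$ on $T^2$, with $h\colon T^2\to\mathbb R$ of class $C^1$, is called a Denjoy vector field if its first return map $\Phi$ to the circle $\{y=0\}$ is a Denjoy map, i.e. an orientation preserving homeomorphism of $S^1=\mathbb R/\mathbb Z$ with irrational rotation number and no dense orbit. Its Denjoy continuum $\mathfrak D\subset T^2$ is the unique minimal set (minimal nonempty closed invariant set) of its flow. For every $\beta\in(0,1)$ there is a constant $k>0$ such that the numbers $$l_n=k\,(|n|+2)^{-1}\bigl(\log(|n|+2)\bigr)^{-1/\beta},\qquad n\in\mathbb Z,$$ satisfy $\sum_{n\in\mathbb Z} l_n<1$, and there is a Denjoy vector field $\partial_y+h\,\partial_x$ on $T^2$, with return map $\Phi$ and a Denjoy continuum $\mathfrak D$ (so the minimal set of the flow exists and is unique), with the following properties. (0) There are pairwise disjoint closed arcs $I_n\subset S^1$, $n\in\mathbb Z$, with $I_n$ of length $l_n$, such that $\Phi(I_n)=I_{n+1}$ for all $n$ and $\{x\in S^1 : (x,0)\in\mathfrak D\}=S^1\setminus\bigcup_{n\in\mathbb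 Z}\operatorname{Int}(I_n)$. (1) $h$ is of class $C^{1+\alpha}$ for every $\alpha\in(0,1)$, i.e. $h$ is $C^1$ and its first derivative is $\alpha$-Hölder. (2) $\partial_x h$ vanishes on $\mathfrak D$. (3) The function $(x,y)\mapsto\int_0^x(\partial_x h(\xi,y))^2\,d\xi$ is of class $C^2$ on $\mathbb R^2$, where $h$ is regarded as a $\mathbb Z^2$-periodic function on $\mathbb R^2$. -/

import Mathlib

open scoped NNReal

noncomputable section

/-- The two-torus `ℝ²/ℤ²`, with coordinates `(x, y)`. -/
abbrev Torus : Type := UnitAddCircle × UnitAddCircle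

/-- The universal covering `ℝ² → T²`. -/
def torusProj (p : ℝ × ℝ) : Torus := ((p.1 : UnitAddCircle), (p.2 : UnitAddCircle))

/-- The lift to `ℝ²` of a function on the torus; it is periodic under `ℤ²`. -/
def torusLift (h : Torus → ℝ) (p : ℝ × ℝ) : ℝ := h (torusProj p)

/-- The partial derivative `∂ₓ h` at the point with coordinates `(x, y)`. -/
def partialX (h : Torus → ℝ) (x y : ℝ) : ℝ := deriv (fun ξ : ℝ => torusLift h (ξ, y)) x

/-- `h` is of class `C^{1+α}`: it is `C¹` and its first derivative is `α`-Hölder. -/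
def IsC1Holder (h : Torus → ℝ) (α : ℝ≥0) : Prop :=
  ContDiff ℝ 1 (torusLift h) ∧ ∃ C : ℝ≥0, HolderWith C α (fderiv ℝ (torusLift h))

/-- `γ` is a (complete) integral curve, lifted to `ℝ²`, of the vector field
`∂_y + h ∂_x` on the torus. -/
def IsTrajectory (h : Torus → ℝ) (γ : ℝ → ℝ × ℝ) : Prop :=
  ∀ t : ℝ, HasDerivAt γ (torusLift h (γ t), 1) t

/-- `S` is invariant under the flow of `∂_y + h ∂_x`. -/
def IsFlowInvariant (h : Torus → ℝ) (S : Set Torus) : Prop :=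
  ∀ γ : ℝ → ℝ × ℝ, IsTrajectory h γ →
    ∀ s t : ℝ, torusProj (γ s) ∈ S → torusProj (γ t) ∈ S

/-- `S` is a minimal set of `∂_y + h ∂_x`: a nonempty closed invariant set with no
proper nonempty closed invariant subset. -/
def IsMinimalSet (h : Torus → ℝ) (S : Set Torus) : Prop :=
  S.Nonempty ∧ IsClosed S ∧ IsFlowInvariant h S ∧
    ∀ S' : Set Torus, S' ⊆ S → S'.Nonempty → IsClosed S' → IsFlowInvariant h S' → S' = S

/-- `Φ` is the first return map of `∂_y + h ∂_x` to the circle `{y = 0}`. Since the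
`y`-component of the field is `1`, the return time is `1`. -/
def IsReturnMap (h : Torus → ℝ) (Φ : UnitAddCircle ≃ₜ UnitAddCircle) : Prop :=
  ∀ γ : ℝ → ℝ × ℝ, IsTrajectory h γ → (γ 0).2 = 0 →
    Φ ((γ 0).1 : UnitAddCircle) = ((γ 1).1 : UnitAddCircle)

/-- A Denjoy map: an orientation preserving homeomorphism of the circle which has
irrational rotation number but no dense orbit. -/
def IsDenjoyMap (Φ : UnitAddCircle ≃ₜ UnitAddCircle) : Prop :=
  (∃ f : CircleDeg1Lift, (∀ x : ℝ, ((f x : ℝ) : UnitAddCircle) = Φ (x : UnitAddCircle)) ∧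
    Irrational f.translationNumber) ∧
  ∀ x : UnitAddCircle, ¬ Dense (Set.range fun n : ℤ => (Φ ^ n) x)

/-- `∂_y + h ∂_x` is a Denjoy vector field: it is `C¹` (so that it has a flow) and its
return map to `{y = 0}` is a Denjoy map. -/
def IsDenjoyField (h : Torus → ℝ) : Prop :=
  ContDiff ℝ 1 (torusLift h) ∧
    ∃ Φ : UnitAddCircle ≃ₜ UnitAddCircle, IsReturnMap h Φ ∧ IsDenjoyMap Φ

/-- `D` is the Denjoy continuum of `∂_y + h ∂_x`: the unique minimal set of its flow. -/
def IsDenjoyContinuum (h : Torus → ℝ) (D : Set Torus) : Prop :=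
  IsMinimalSet h D ∧ ∀ D' : Set Torus, IsMinimalSet h D' → D' = D

/-- The closed arc of the circle of length `ℓ` (for `0 < ℓ < 1`) starting at `a`. -/
def closedArc (a ℓ : ℝ) : Set UnitAddCircle :=
  (fun x : ℝ => (x : UnitAddCircle)) '' Set.Icc a (a + ℓ)

/-- The corresponding open arc. -/
def openArc (a ℓ : ℝ) : Set UnitAddCircle :=
  (fun x : ℝ => (x : UnitAddCircle)) '' Set.Ioo a (a + ℓ)

/-- `Φ` permutes pairwise disjoint closed arcs `I_n` (`n ∈ ℤ`), where `I_n` has length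
`ℓ n` and `Φ(I_n) = I_{n+1}`, and `K` is the complement of the union of their interiors. -/
def IsBuiltFromArcs (Φ : UnitAddCircle ≃ₜ UnitAddCircle) (K : Set UnitAddCircle)
    (ℓ : ℤ → ℝ) : Prop :=
  ∃ a : ℤ → ℝ,
    (∀ m n : ℤ, m ≠ n → Disjoint (closedArc (a m) (ℓ m)) (closedArc (a n) (ℓ n))) ∧
    (∀ n : ℤ, Φ '' closedArc (a n) (ℓ n) = closedArc (a (n + 1)) (ℓ (n + 1))) ∧
    K = (⋃ n : ℤ, openArc (a n) (ℓ n))ᶜ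

/-- The lengths `k (|n| + 2)⁻¹ (log (|n| + 2))^{-1/β}`. -/
def arcLength (β k : ℝ) (n : ℤ) : ℝ :=
  k * (|(n : ℝ)| + 2)⁻¹ * (Real.log (|(n : ℝ)| + 2)) ^ (-(1 / β))

end

open scoped ContDiff
open Filter Topology Set

/-! The return map is a Denjoy homeomorphism obtained by blowing up an orbit of the rotation by an
irrational θ. The monotone map X = `jumpL` jumps by `l n` at the points nθ + m. The gaps in its
image are the lifted arcs, and the lift F of the return map satisfies F(X(s)) = X(s + θ). Its
derivative is 1 + q, where q vanishes off the gaps and equals r_n = `relIncr l n` times a rescaled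
bump of unit mass on the n-th gap, so that F stretches a length l_n to l_{n+1}.

Regularity rests on r_n = O(1/|n|). Since 1/|n| = o(l_n^α) for α < 1, q is α-Hölder
(`exists_holderWith_gapSum`). No bound on q' is available, but (q²)' has size r_n²/l_n, which tends
to 0, so q² is C¹. This is recorded in `exists_isDisplacement`.

To suspend F, put ψ = F − id and H(z, y) = z + χ(y)ψ(z) with a cutoff χ, and let h be the velocity
of this isotopy: h = χ'(y)ψ(Z(x, y)), where Z = `label` inverts H in its first variable. As χ is
constant near 0 and 1, h extends periodically in y. Now ∂ₓh = χ' q(Z)/(1 + χ q(Z)) inherits the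
Hölder property and vanishes on the suspension of the Cantor set. The substitution x = H(z, y) turns
∫(∂ₓh)² dx into the integral of q²χ'²/(1 + χq) dz from Z(0, y) to Z(x, y). An integrand q²U(q, y)
with U smooth is C¹ because q² is (`contDiff_sq_mul_comp`). The first partial derivatives of the
integral are built from such terms, so it is C² (`contDiff_integral_fieldX_sq`).

For the dynamics, Z is constant along trajectories over one period, so F lifts the return map. The
semiconjugacy X gives the rotation number θ, and the wandering gaps exclude dense orbits. Density of
rotation orbits makes every orbit accumulate on the whole Cantor set, so its suspension is the only
minimal set (`suspension_subset`). -/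

/-- The profile `x⁻¹ (log x)^{-p}`. -/
noncomputable def gapProfile (p x : ℝ) : ℝ := x⁻¹ * (Real.log x) ^ (-p)

/-! ### Asymptotics of the arc lengths -/

lemma gapProfile_pos {p x : ℝ} (hx : 2 ≤ x) : 0 < gapProfile p x := by
  have : 0 < Real.log x := Real.log_pos (by linarith)
  unfold gapProfile
  positivity

lemma gapProfile_anti {p x y : ℝ} (hp : 0 ≤ p) (hx : 2 ≤ x) (hxy : x ≤ y) :
    gapProfile p y ≤ gapProfile p x := by
  have h1 : 0 < Real.log x := Real.log_pos (by linarith)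
  unfold gapProfile
  refine mul_le_mul (inv_anti₀ (by linarith) hxy) ?_ ?_ (by positivity)
  · exact Real.rpow_le_rpow_of_nonpos h1 (Real.log_le_log (by linarith) hxy) (by linarith)
  · exact Real.rpow_nonneg (h1.le.trans (Real.log_le_log (by linarith) hxy)) _

lemma gapProfile_ratio {p x : ℝ} (hx : 2 ≤ x) :
    gapProfile p (x + 1) / gapProfile p x
      = x / (x + 1) * (Real.log x / Real.log (x + 1)) ^ p := by
  have h1 : 0 < Real.log x := Real.log_pos (by linarith)
  have h2 : 0 < Real.log (x + 1) := Real.log_pos (by linarith)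
  unfold gapProfile
  rw [Real.rpow_neg h1.le, Real.rpow_neg h2.le, Real.div_rpow h1.le h2.le]
  have := Real.rpow_pos_of_pos h1 p
  have := Real.rpow_pos_of_pos h2 p
  field_simp

lemma one_le_log_add_one {x : ℝ} (hx : 2 ≤ x) : 1 ≤ Real.log (x + 1) := by
  rw [Real.le_log_iff_exp_le (by linarith)]
  linarith [Real.exp_one_lt_d9]

lemma gapProfile_ratio_le_one {p x : ℝ} (hp : 0 ≤ p) (hx : 2 ≤ x) :
    gapProfile p (x + 1) / gapProfile p x ≤ 1 := by
  rw [div_le_one (gapProfile_pos hx)]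
  exact gapProfile_anti hp hx (by linarith)

/-- Both factors of the ratio differ from 1 by `O(1 / x)`. For the power, Bernoulli's inequality
reduces to the quotient of logarithms, whose defect is at most `log (x + 1) - log x` because `log (x
+ 1) ≥ 1`. -/
lemma one_sub_gapProfile_ratio_le {p x : ℝ} (hp : 1 ≤ p) (hx : 2 ≤ x) :
    1 - gapProfile p (x + 1) / gapProfile p x ≤ (1 + p) / x := by
  have h1 : 0 < Real.log x := Real.log_pos (by linarith)
  have h2 := one_le_log_add_one hx
  have hle : Real.log x ≤ Real.log (x + 1) := Real.log_le_log (by linarith) (by linarith)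
  rw [gapProfile_ratio hx]
  set r := Real.log x / Real.log (x + 1) with hr
  have hr0 : 0 ≤ r := by positivity
  have hr1 : r ≤ 1 := by rw [hr, div_le_one (by linarith)]; exact hle
  have hb := one_add_mul_self_le_rpow_one_add (s := r - 1) (by linarith) hp
  rw [show 1 + (r - 1) = r by ring] at hb
  have hdiff : 1 - r ≤ 1 / x := by
    have h3 : Real.log (x + 1) - Real.log x ≤ 1 / x := by
      rw [← Real.log_div (by linarith) (by linarith)]
      refine (Real.log_le_sub_one_of_pos (by positivity)).trans (le_of_eq ?_)
      field_simp
      ring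
    have h4 : 1 - r = (Real.log (x + 1) - Real.log x) / Real.log (x + 1) := by
      rw [hr]; field_simp
    rw [h4]
    exact (div_le_self (by linarith) h2).trans h3
  have hp1 : r ^ p ≤ 1 := Real.rpow_le_one hr0 hr1 (by linarith)
  have hx1 : 1 - x / (x + 1) ≤ 1 / x := by
    have : 1 - x / (x + 1) = 1 / (x + 1) := by field_simp; ring
    rw [this]
    exact one_div_le_one_div_of_le (by linarith) (by linarith)
  have hx2 : x / (x + 1) ≤ 1 := by rw [div_le_one (by linarith)]; linarith
  have h5 : 1 - r ^ p ≤ p * (1 / x) := by nlinarith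
  have h6 : (0:ℝ) ≤ x / (x + 1) := by positivity
  have : (1 + p) / x = 1 / x + p * (1 / x) := by ring
  rw [this]
  nlinarith

lemma le_gapProfile_ratio {p x : ℝ} (hp : 0 ≤ p) (hx : 2 ≤ x) :
    2 / 3 * (1 / 2 : ℝ) ^ p ≤ gapProfile p (x + 1) / gapProfile p x := by
  have h1 : 0 < Real.log x := Real.log_pos (by linarith)
  have h2 := one_le_log_add_one hx
  rw [gapProfile_ratio hx]
  refine mul_le_mul ?_ (Real.rpow_le_rpow (by norm_num) ?_ hp) (by positivity) (by positivity)
  · rw [div_le_div_iff₀ (by norm_num) (by linarith)]; linarith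
  · rw [div_le_div_iff₀ (by norm_num) (by linarith)]
    -- For `x ≥ 2` one has `x + 1 ≤ x ^ 2`, so the logarithm at most doubles.
    have : Real.log (x + 1) ≤ Real.log (x ^ 2) := Real.log_le_log (by linarith) (by nlinarith)
    rw [Real.log_pow] at this
    push_cast at this
    linarith

/-- Cauchy condensation leaves `∑ n ^ (-p)` up to a constant. The index shift keeps the arguments `2
^ (n + 1)` at least 2, where the profile is monotone. -/
lemma summable_gapProfile {p : ℝ} (hp : 1 < p) :
    Summable (fun n : ℕ => gapProfile p ((n : ℝ) + 2)) := by
  have h2 : ∀ n : ℕ, (2:ℝ) ≤ (n : ℝ) + 2 := fun n => by linarith [n.cast_nonneg (α := ℝ)]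
  rw [← summable_condensed_iff_of_nonneg (fun n => (gapProfile_pos (h2 n)).le)
    (fun m n _ hmn => gapProfile_anti (by linarith) (h2 m)
      (by have : (m:ℝ) ≤ n := by exact_mod_cast hmn
          linarith)), ← summable_nat_add_iff 1]
  have hs : Summable (fun n : ℕ => (Real.log 2) ^ (-p) * (((n + 1 : ℕ) : ℝ) ^ p)⁻¹) :=
    ((summable_nat_add_iff 1).2 (Real.summable_nat_rpow_inv.2 hp)).mul_left _
  refine Summable.of_nonneg_of_le (fun n => ?_) (fun n => ?_) hs
  · exact mul_nonneg (by positivity) (gapProfile_pos (h2 _)).le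
  · have h3 : (2:ℝ) ≤ 2 ^ (n + 1) := by
      rw [pow_succ]; nlinarith [one_le_pow₀ (M₀ := ℝ) (a := 2) (by norm_num) (n := n)]
    have hl : 0 < Real.log 2 := Real.log_pos (by norm_num)
    calc (2:ℝ) ^ (n + 1) * gapProfile p (((2 ^ (n + 1) : ℕ) : ℝ) + 2)
        ≤ 2 ^ (n + 1) * gapProfile p (2 ^ (n + 1)) := by
          refine mul_le_mul_of_nonneg_left ?_ (by positivity)
          push_cast
          exact gapProfile_anti (by linarith) h3 (by linarith)
      _ = (Real.log 2) ^ (-p) * (((n + 1 : ℕ) : ℝ) ^ p)⁻¹ := by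
          unfold gapProfile
          rw [Real.log_pow, ← mul_assoc, mul_inv_cancel₀ (by positivity), one_mul,
            Real.mul_rpow (by positivity) hl.le, mul_comm, Real.rpow_neg (Nat.cast_nonneg _)]
      _ ≤ _ := le_rfl

lemma arcLength_eq (β k : ℝ) (n : ℤ) :
    arcLength β k n = k * gapProfile (1 / β) (|(n : ℝ)| + 2) := by
  unfold arcLength gapProfile; ring

lemma summable_arcLength {β : ℝ} (k : ℝ) (hβ0 : 0 < β) (hβ1 : β < 1) :
    Summable (arcLength β k) := by
  have hs := summable_gapProfile (one_lt_one_div hβ0 hβ1)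
  have : Summable (fun n : ℤ => gapProfile (1 / β) (|(n : ℝ)| + 2)) := by
    refine Summable.of_nat_of_neg ?_ ?_ <;> simpa using hs
  exact (this.mul_left k).congr (fun n => (arcLength_eq β k n).symm)

lemma arcLength_pos {β k : ℝ} (hk : 0 < k) (n : ℤ) : 0 < arcLength β k n := by
  rw [arcLength_eq]
  exact mul_pos hk (gapProfile_pos (by linarith [abs_nonneg (n : ℝ)]))

lemma exists_arcLength_tsum_eq_half {β : ℝ} (hβ0 : 0 < β) (hβ1 : β < 1) :
    ∃ k : ℝ, 0 < k ∧ ∑' n : ℤ, arcLength β k n = 1 / 2 := by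
  have hs := summable_arcLength 1 hβ0 hβ1
  have hpos : 0 < ∑' n : ℤ, arcLength β 1 n :=
    hs.tsum_pos (fun n => (arcLength_pos one_pos n).le) 0 (arcLength_pos one_pos 0)
  refine ⟨1 / (2 * ∑' n : ℤ, arcLength β 1 n), by positivity, ?_⟩
  have : ∀ n, arcLength β (1 / (2 * ∑' n : ℤ, arcLength β 1 n)) n
      = 1 / (2 * ∑' n : ℤ, arcLength β 1 n) * arcLength β 1 n := fun n => by
    rw [arcLength_eq, arcLength_eq, one_mul]
  simp_rw [this]
  rw [tsum_mul_left]
  field_simp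

/-- The relative increment of the arc lengths. -/
noncomputable def relIncr (l : ℤ → ℝ) (n : ℤ) : ℝ := l (n + 1) / l n - 1

/-- For `n ≥ 0` the quotient of lengths is a ratio `ρ ≤ 1` of profile values at consecutive points.
For `n < 0` it is `ρ⁻¹`, and `(1 - ρ) / ρ` needs the lower bound of `ρ`, which is why that bound
divides the constant. The factor 2 pays for replacing `|n| + 1` by `|n| + 2`. -/
lemma relIncr_arcLength_bounds {β k : ℝ} (hk : 0 < k) (hβ0 : 0 < β) (hβ1 : β < 1) (n : ℤ) :
    2 / 3 * (1 / 2 : ℝ) ^ (1 / β) - 1 ≤ relIncr (arcLength β k) n ∧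
    |relIncr (arcLength β k) n|
      ≤ 2 * (1 + 1 / β) / (2 / 3 * (1 / 2 : ℝ) ^ (1 / β)) / (|(n : ℝ)| + 2) := by
  set p := 1 / β with hp
  have hp1 : 1 < p := one_lt_one_div hβ0 hβ1
  set m := 2 / 3 * (1 / 2 : ℝ) ^ p with hm
  have hm0 : 0 < m := by positivity
  have hm1 : m ≤ 1 := by
    have := Real.rpow_le_one (x := (1/2:ℝ)) (z := p) (by norm_num) (by norm_num) (by linarith)
    linarith
  have hrel : relIncr (arcLength β k) n
      = gapProfile p (|(n : ℝ) + 1| + 2) / gapProfile p (|(n : ℝ)| + 2) - 1 := by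
    unfold relIncr
    rw [arcLength_eq, arcLength_eq, mul_div_mul_left _ _ hk.ne']
    push_cast
    rfl
  rw [hrel]
  rcases le_or_gt 0 n with hn | hn
  · have hn' : (0:ℝ) ≤ n := by exact_mod_cast hn
    rw [abs_of_nonneg hn', abs_of_nonneg (by linarith), show (n:ℝ) + 1 + 2 = n + 2 + 1 by ring]
    have hx : (2:ℝ) ≤ n + 2 := by linarith
    have a1 := le_gapProfile_ratio (p := p) (by linarith) hx
    have a2 := gapProfile_ratio_le_one (p := p) (by linarith) hx
    have a3 := one_sub_gapProfile_ratio_le hp1.le hx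
    refine ⟨by linarith, ?_⟩
    rw [abs_sub_comm, abs_of_nonneg (by linarith)]
    refine a3.trans ?_
    gcongr
    rw [le_div_iff₀ hm0]
    nlinarith
  · have hn' : (n:ℝ) + 1 ≤ 0 := by exact_mod_cast hn
    rw [abs_of_neg (show (n:ℝ) < 0 by linarith), abs_of_nonpos hn']
    set x : ℝ := -(n + 1) + 2 with hxdef
    have hx : 2 ≤ x := by linarith
    rw [show -(n:ℝ) + 2 = x + 1 by rw [hxdef]; ring]
    have a1 := le_gapProfile_ratio (p := p) (by linarith) hx
    have a2 := gapProfile_ratio_le_one (p := p) (by linarith) hx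
    have a3 := one_sub_gapProfile_ratio_le hp1.le hx
    have g1 := gapProfile_pos (p := p) hx
    have g2 := gapProfile_pos (p := p) (show 2 ≤ x + 1 by linarith)
    rw [← inv_div]
    set ρ := gapProfile p (x + 1) / gapProfile p x with hρ
    have hρ0 : 0 < ρ := by linarith
    have hinv : 1 ≤ ρ⁻¹ := (one_le_inv₀ hρ0).2 a2
    refine ⟨by linarith, ?_⟩
    rw [abs_of_nonneg (by linarith), show ρ⁻¹ - 1 = (1 - ρ) / ρ by field_simp, div_div,
      div_le_div_iff₀ hρ0 (by positivity)]
    have h1 : (1 - ρ) * x ≤ 1 + p := by rwa [le_div_iff₀ (by linarith)] at a3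
    have h2 : (1 - ρ) * (m * (x + 1)) ≤ m * (2 * (1 + p)) := by
      nlinarith [mul_nonneg (show 0 ≤ 1 - ρ by linarith) hm0.le]
    nlinarith

lemma tendsto_relIncr_arcLength {β k : ℝ} (hk : 0 < k) (hβ0 : 0 < β) (hβ1 : β < 1)
    {α : ℝ} (hα1 : α < 1) :
    Tendsto (fun n => |relIncr (arcLength β k) n| / (arcLength β k n) ^ α) cofinite (𝓝 0) := by
  set p := 1 / β with hp
  have hp1 : 1 < p := one_lt_one_div hβ0 hβ1
  set C := 2 * (1 + 1 / β) / (2 / 3 * (1 / 2 : ℝ) ^ (1 / β)) with hC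
  have hC0 : 0 ≤ C := by positivity
  have hlim : Tendsto (fun x : ℝ => C / k ^ α * (Real.log x ^ (p * α) / x ^ (1 - α)))
      atTop (𝓝 0) := by
    have := (isLittleO_log_rpow_rpow_atTop (p * α) (show 0 < 1 - α by linarith)).tendsto_div_nhds_zero
    simpa using this.const_mul (C / k ^ α)
  have habs : Tendsto (fun n : ℤ => |(n : ℝ)| + 2) cofinite atTop := by
    refine tendsto_atTop_add_const_right _ _ ?_
    rw [Int.cofinite_eq, tendsto_sup]
    exact ⟨tendsto_abs_atBot_atTop.comp (tendsto_intCast_atBot_iff.2 tendsto_id),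
      tendsto_abs_atTop_atTop.comp tendsto_intCast_atTop_atTop⟩
  refine squeeze_zero (fun n => ?_) (fun n => ?_) (hlim.comp habs)
  · exact div_nonneg (abs_nonneg _) (Real.rpow_nonneg (arcLength_pos hk n).le _)
  · have hx : (2:ℝ) ≤ |(n:ℝ)| + 2 := by linarith [abs_nonneg (n : ℝ)]
    have hb := (relIncr_arcLength_bounds hk hβ0 hβ1 n).2
    rw [← hC] at hb
    clear_value C
    simp only [Function.comp]
    rw [arcLength_eq]
    set x := |(n:ℝ)| + 2
    have hx0 : 0 < x := by linarith
    have hl : 0 < Real.log x := Real.log_pos (by linarith)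
    have e : (k * gapProfile p x) ^ α = k ^ α * (x ^ α)⁻¹ * (Real.log x ^ (p * α))⁻¹ := by
      rw [Real.mul_rpow hk.le (gapProfile_pos hx).le, gapProfile,
        Real.mul_rpow (by positivity) (by positivity), Real.inv_rpow hx0.le,
        ← Real.rpow_mul hl.le, neg_mul, Real.rpow_neg hl.le, mul_assoc]
    rw [e]
    have hkα := Real.rpow_pos_of_pos hk α
    have hxα := Real.rpow_pos_of_pos hx0 α
    have hlα := Real.rpow_pos_of_pos hl (p * α)
    rw [div_le_iff₀ (by positivity)]
    refine hb.trans (le_of_eq ?_)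
    rw [Real.rpow_sub hx0, Real.rpow_one]
    field_simp

/-! ### The semiconjugacy with a rotation and its gaps -/

/-- Lengths of gaps: a positive summable family of total mass less than one, whose relative
increments are bounded below by some number greater than `-1` and decay faster than every power
`l ^ α`, `α < 1`. -/
structure IsGapSeq (l : ℤ → ℝ) : Prop where
  pos : ∀ n, 0 < l n
  summable : Summable l
  tsum_lt : ∑' n, l n < 1
  tendsto : ∀ α : ℝ, 0 ≤ α → α < 1 → Tendsto (fun n => |relIncr l n| / (l n) ^ α) cofinite (𝓝 0)
  lower : ∃ ρ : ℝ, 0 < ρ ∧ ∀ n, ρ - 1 ≤ relIncr l n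

namespace IsGapSeq

variable {l : ℤ → ℝ} (hl : IsGapSeq l) {θ : ℝ} (hθ : Irrational θ)

/-- Left continuous semiconjugacy from the rotation by `θ`; it jumps by `l n` at `n θ + m`. -/
noncomputable def jumpL (l : ℤ → ℝ) (θ s : ℝ) : ℝ :=
  s + ∑' n : ℤ, l n * (⌈s - n * θ⌉ - (s - n * θ))

/-- Right continuous version of `jumpL`. -/
noncomputable def jumpR (l : ℤ → ℝ) (θ s : ℝ) : ℝ :=
  s + ∑' n : ℤ, l n * (⌊s - n * θ⌋ + 1 - (s - n * θ))

lemma ceil_sub_mem (t : ℝ) : (⌈t⌉ : ℝ) - t ∈ Icc (0:ℝ) 1 :=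
  ⟨by linarith [Int.le_ceil t], by linarith [Int.ceil_lt_add_one t]⟩

lemma floor_add_one_sub_mem (t : ℝ) : (⌊t⌋ : ℝ) + 1 - t ∈ Icc (0:ℝ) 1 :=
  ⟨by linarith [Int.lt_floor_add_one t], by linarith [Int.floor_le t]⟩

include hl

lemma lt_one (n : ℤ) : l n < 1 :=
  (hl.summable.le_tsum n (fun _ _ => (hl.pos _).le)).trans_lt hl.tsum_lt

lemma summable_mul {u : ℤ → ℝ} (hu : ∀ n, u n ∈ Icc (0:ℝ) 1) : Summable (fun n => l n * u n) :=
  Summable.of_nonneg_of_le (fun n => mul_nonneg (hl.pos n).le (hu n).1)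
    (fun n => mul_le_of_le_one_right (hl.pos n).le (hu n).2) hl.summable

lemma tsum_mul_mem {u : ℤ → ℝ} (hu : ∀ n, u n ∈ Icc (0:ℝ) 1) :
    ∑' n, l n * u n ∈ Icc (0:ℝ) 1 :=
  ⟨tsum_nonneg fun n => mul_nonneg (hl.pos n).le (hu n).1,
    ((hl.summable_mul hu).tsum_le_tsum
      (fun n => mul_le_of_le_one_right (hl.pos n).le (hu n).2) hl.summable).trans hl.tsum_lt.le⟩

omit hl in
lemma jumpL_add_int (s : ℝ) (m : ℤ) : jumpL l θ (s + m) = jumpL l θ s + m := by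
  have : ∀ n : ℤ, (⌈s + m - n * θ⌉ : ℝ) - (s + m - n * θ) = ⌈s - n * θ⌉ - (s - n * θ) := fun n => by
    rw [show s + m - n * θ = s - n * θ + m by ring, Int.ceil_add_intCast]; push_cast; ring
  simp only [jumpL, this]; ring

lemma jumpL_le_jumpR (s : ℝ) : jumpL l θ s ≤ jumpR l θ s := by
  unfold jumpL jumpR
  gcongr ?_ + ?_
  · exact le_rfl
  refine (hl.summable_mul fun n => ceil_sub_mem _).tsum_le_tsum (fun n => ?_)
    (hl.summable_mul fun n => floor_add_one_sub_mem _)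
  have : (⌈s - n * θ⌉ : ℝ) ≤ ⌊s - n * θ⌋ + 1 := by exact_mod_cast Int.ceil_le_floor_add_one _
  exact mul_le_mul_of_nonneg_left (by linarith) (hl.pos n).le

/-- The linear part has slope `1 - ∑' n, l n > 0`, and the remaining step functions compare through
`⌊t⌋ + 1 ≤ ⌈t'⌉` for `t < t'`. -/
lemma jumpR_lt_jumpL {s s' : ℝ} (h : s < s') : jumpR l θ s < jumpL l θ s' := by
  have key : jumpR l θ s + (s' - s) * (1 - ∑' n, l n) ≤ jumpL l θ s' := by
    unfold jumpL jumpR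
    have h1 := hl.summable_mul (fun n => floor_add_one_sub_mem (s - n * θ))
    have h2 := hl.summable_mul (fun n => ceil_sub_mem (s' - n * θ))
    have h3 : ∑' n : ℤ, (l n * (⌊s - n * θ⌋ + 1 - (s - n * θ)) - (s' - s) * l n)
        ≤ ∑' n : ℤ, l n * (⌈s' - n * θ⌉ - (s' - n * θ)) := by
      refine (h1.sub (hl.summable.mul_left _)).tsum_le_tsum (fun n => ?_) h2
      have : (⌊s - n * θ⌋ : ℝ) + 1 ≤ ⌈s' - n * θ⌉ := by
        have : ⌊s - n * θ⌋ < ⌈s' - n * θ⌉ := by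
          rw [Int.lt_ceil]
          exact (Int.floor_le _).trans_lt (by linarith)
        exact_mod_cast this
      nlinarith [hl.pos n]
    rw [(h1.tsum_sub (hl.summable.mul_left _)), tsum_mul_left] at h3
    linarith
  have := mul_pos (sub_pos.2 h) (sub_pos.2 hl.tsum_lt)
  linarith

lemma jumpL_strictMono : StrictMono (jumpL l θ) := fun _ _ h =>
  (hl.jumpL_le_jumpR _).trans_lt (hl.jumpR_lt_jumpL h)

lemma jumpL_mem (s : ℝ) : jumpL l θ s ∈ Icc s (s + 1) := by
  have := hl.tsum_mul_mem (fun n => ceil_sub_mem (s - n * θ))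
  exact ⟨by unfold jumpL; linarith [this.1], by unfold jumpL; linarith [this.2]⟩

lemma tendsto_jumpL (s : ℝ) : Tendsto (jumpL l θ) (𝓝[≤] s) (𝓝 (jumpL l θ s)) := by
  refine (tendsto_id'.2 nhdsWithin_le_nhds).add ?_
  refine tendsto_tsum_of_dominated_convergence hl.summable (fun n => ?_)
    (Eventually.of_forall fun x n => ?_)
  · have h1 : Tendsto (fun x : ℝ => x - n * θ) (𝓝[≤] s) (𝓝[≤] (s - n * θ)) := by
      refine tendsto_nhdsWithin_iff.2 ⟨((continuous_id.sub continuous_const).tendsto s).mono_left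
        nhdsWithin_le_nhds, ?_⟩
      filter_upwards [self_mem_nhdsWithin] with x hx
      exact mem_Iic.2 (sub_le_sub_right (mem_Iic.1 hx) _)
    have h2 := (tendsto_pure.1 (tendsto_ceil_left_pure_ceil (s - n * θ)))
    have h3 : Tendsto (fun x : ℝ => l n * ((⌈s - n * θ⌉ : ℝ) - (x - n * θ))) (𝓝[≤] s)
        (𝓝 (l n * (⌈s - n * θ⌉ - (s - n * θ)))) :=
      ((show Continuous (fun x : ℝ => l n * ((⌈s - n * θ⌉ : ℝ) - (x - n * θ))) by
        fun_prop).tendsto s).mono_left nhdsWithin_le_nhds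
    refine h3.congr' ?_
    filter_upwards [h1.eventually h2] with x hx
    rw [hx]
  · have := ceil_sub_mem (x - n * θ)
    rw [Real.norm_of_nonneg (mul_nonneg (hl.pos n).le this.1)]
    exact mul_le_of_le_one_right (hl.pos n).le this.2

lemma tendsto_jumpR (s : ℝ) : Tendsto (jumpR l θ) (𝓝[≥] s) (𝓝 (jumpR l θ s)) := by
  refine (tendsto_id'.2 nhdsWithin_le_nhds).add ?_
  refine tendsto_tsum_of_dominated_convergence hl.summable (fun n => ?_)
    (Eventually.of_forall fun x n => ?_)
  · have h1 : Tendsto (fun x : ℝ => x - n * θ) (𝓝[≥] s) (𝓝[≥] (s - n * θ)) := by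
      refine tendsto_nhdsWithin_iff.2 ⟨((continuous_id.sub continuous_const).tendsto s).mono_left
        nhdsWithin_le_nhds, ?_⟩
      filter_upwards [self_mem_nhdsWithin] with x hx
      exact mem_Ici.2 (sub_le_sub_right (mem_Ici.1 hx) _)
    have h2 := (tendsto_pure.1 (tendsto_floor_right_pure_floor (s - n * θ)))
    have h3 : Tendsto (fun x : ℝ => l n * ((⌊s - n * θ⌋ : ℝ) + 1 - (x - n * θ))) (𝓝[≥] s)
        (𝓝 (l n * (⌊s - n * θ⌋ + 1 - (s - n * θ)))) :=
      ((show Continuous (fun x : ℝ => l n * ((⌊s - n * θ⌋ : ℝ) + 1 - (x - n * θ))) by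
        fun_prop).tendsto s).mono_left nhdsWithin_le_nhds
    refine h3.congr' ?_
    filter_upwards [h1.eventually h2] with x hx
    rw [hx]
  · have := floor_add_one_sub_mem (x - n * θ)
    rw [Real.norm_of_nonneg (mul_nonneg (hl.pos n).le this.1)]
    exact mul_le_of_le_one_right (hl.pos n).le this.2

/-- Every point lies between the one-sided values of the semiconjugacy at some point. -/
lemma exists_between_jump (z : ℝ) : ∃ s, jumpL l θ s ≤ z ∧ z ≤ jumpR l θ s := by
  set S := {s | jumpL l θ s ≤ z} with hS
  have hne : S.Nonempty := ⟨z - 1, by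
    have := (hl.jumpL_mem (θ := θ) (z - 1)).2
    show jumpL l θ (z - 1) ≤ z
    linarith⟩
  have hbdd : BddAbove S := ⟨z, fun s hs => ((hl.jumpL_mem s).1).trans hs⟩
  refine ⟨sSup S, ?_, ?_⟩
  · have hlub := isLUB_csSup hne hbdd
    have hfr := hlub.frequently_mem hne
    exact isClosed_Iic.mem_of_frequently_of_tendsto hfr (hl.tendsto_jumpL (sSup S))
  · have h1 : Tendsto (jumpR l θ) (𝓝[>] sSup S) (𝓝 (jumpR l θ (sSup S))) :=
      (hl.tendsto_jumpR (sSup S)).mono_left (nhdsWithin_mono _ Ioi_subset_Ici_self)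
    refine ge_of_tendsto h1 ?_
    filter_upwards [self_mem_nhdsWithin] with s hs
    have : s ∉ S := fun h => (le_csSup hbdd h).not_gt hs
    exact (not_le.1 this).le.trans (hl.jumpL_le_jumpR s)

/-- Left end point of the `n`-th gap. -/
noncomputable def leftEnd (l : ℤ → ℝ) (θ : ℝ) (n : ℤ) : ℝ := jumpL l θ (n * θ)

omit hl in
lemma leftEnd_add (n m : ℤ) : leftEnd l θ n + m = jumpL l θ (n * θ + m) :=
  (jumpL_add_int _ _).symm

omit hl in
include hθ in
lemma eq_of_mul_add_eq {n m n' m' : ℤ} (h : n * θ + m = n' * θ + m') : n = n' ∧ m = m' := by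
  have hn : n = n' := by
    by_contra hne
    refine hθ ⟨((m' - m : ℤ) : ℚ) / ((n - n' : ℤ) : ℚ), ?_⟩
    have : ((n:ℝ) - n') ≠ 0 := sub_ne_zero.2 (by exact_mod_cast hne)
    push_cast
    field_simp
    linarith
  subst hn
  exact ⟨rfl, by exact_mod_cast add_left_cancel h⟩

include hθ

/-- The two series differ only in terms whose argument is an integer; by irrationality `n * θ + m -
k * θ` is an integer only for `k = n`. -/
lemma jumpR_orbit (n m : ℤ) : jumpR l θ (n * θ + m) = leftEnd l θ n + m + l n := by
  rw [leftEnd_add]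
  unfold jumpL jumpR
  have h1 := hl.summable_mul (fun k => floor_add_one_sub_mem (n * θ + m - k * θ))
  have h2 := hl.summable_mul (fun k => ceil_sub_mem (n * θ + m - k * θ))
  have : ∑' k : ℤ, (l k * (⌊n * θ + m - k * θ⌋ + 1 - (n * θ + m - k * θ))
      - l k * (⌈n * θ + m - k * θ⌉ - (n * θ + m - k * θ))) = l n := by
    rw [tsum_eq_single n]
    · rw [show n * θ + m - n * θ = (m:ℝ) by ring, Int.floor_intCast, Int.ceil_intCast]; ring
    · intro k hk
      have hne : ∀ j : ℤ, (j : ℝ) ≠ n * θ + m - k * θ := fun j hj => hk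
        (eq_of_mul_add_eq hθ (n := k) (m := j) (n' := n) (m' := m) (by linarith)).1
      have : ⌈(n * θ + m - k * θ : ℝ)⌉ = ⌊(n * θ + m - k * θ : ℝ)⌋ + 1 :=
        (Int.ceil_eq_floor_add_one_iff_notMem _).2 (by rintro ⟨j, hj⟩; exact hne j hj)
      rw [this]; push_cast; ring
  rw [h1.tsum_sub h2] at this
  linarith

omit hl hθ in
lemma jumpR_eq_jumpL {s : ℝ} (hs : ∀ n m : ℤ, s ≠ n * θ + m) : jumpR l θ s = jumpL l θ s := by
  unfold jumpL jumpR
  congr 2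
  ext k
  have : ⌈s - k * θ⌉ = ⌊s - k * θ⌋ + 1 :=
    (Int.ceil_eq_floor_add_one_iff_notMem _).2 (by
      rintro ⟨j, hj⟩; exact hs k j (by linarith))
  rw [this]; push_cast; ring

/-- The lifted gaps are pairwise disjoint. -/
lemma eq_of_mem_gaps {n m n' m' : ℤ} {x : ℝ}
    (h : x ∈ Icc (leftEnd l θ n + m) (leftEnd l θ n + m + l n))
    (h' : x ∈ Icc (leftEnd l θ n' + m') (leftEnd l θ n' + m' + l n')) : n = n' ∧ m = m' := by
  rw [← hl.jumpR_orbit hθ, leftEnd_add] at h h'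
  -- Each gap runs from the left to the right value of the semiconjugacy at a jump point, and gaps
  -- at distinct points are strictly ordered.
  rcases lt_trichotomy ((n:ℝ) * θ + m) (n' * θ + m') with hlt | heq | hlt
  · exact absurd (hl.jumpR_lt_jumpL (θ := θ) hlt) (by linarith [h.2, h'.1])
  · exact eq_of_mul_add_eq hθ heq
  · exact absurd (hl.jumpR_lt_jumpL (θ := θ) hlt) (by linarith [h'.2, h.1])

/-- The part of the image of the semiconjugacy in a translate of the complement of a gap. -/
lemma jumpL_mem_Icc (n : ℤ) (s : ℝ) :
    jumpL l θ s - leftEnd l θ n - (⌈s - n * θ⌉ - 1) ∈ Icc (l n) 1 := by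
  -- Here `s` lies in `(n * θ + j - 1, n * θ + j]`, so its image lies between the end of one
  -- translate of the gap and the start of the next.
  set j := ⌈s - n * θ⌉ with hj
  have h1 : n * θ + (j - 1 : ℤ) < s := by
    have := Int.ceil_lt_add_one (s - n * θ)
    push_cast; rw [← hj] at this; linarith
  have h2 : s ≤ n * θ + j := by linarith [Int.le_ceil (s - n * θ)]
  have h3 := hl.jumpR_lt_jumpL (θ := θ) h1
  have h4 := (hl.jumpL_strictMono (θ := θ)).monotone h2
  rw [hl.jumpR_orbit hθ] at h3
  rw [← leftEnd_add] at h4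
  push_cast at h3
  constructor <;> linarith

/-- The lift of the Cantor set: the complement of the lifted open gaps. -/
def gapCompl (l : ℤ → ℝ) (θ : ℝ) : Set ℝ :=
  {z | ∀ n m : ℤ, z ∉ Ioo (leftEnd l θ n + m) (leftEnd l θ n + m + l n)}

lemma exists_jump_eq {z : ℝ} (hz : z ∈ gapCompl l θ) : ∃ s, z = jumpL l θ s ∨ z = jumpR l θ s := by
  obtain ⟨s, h1, h2⟩ := hl.exists_between_jump (θ := θ) z
  refine ⟨s, ?_⟩
  by_cases hs : ∀ n m : ℤ, s ≠ n * θ + m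
  · rw [jumpR_eq_jumpL hs] at h2
    exact Or.inl (le_antisymm h2 h1)
  · push Not at hs
    obtain ⟨n, m, rfl⟩ := hs
    by_contra! hne
    refine hz n m ⟨?_, ?_⟩
    · rw [leftEnd_add]; exact lt_of_le_of_ne h1 hne.1.symm
    · rw [← hl.jumpR_orbit hθ]; exact lt_of_le_of_ne h2 hne.2

lemma jumpL_mem_gapCompl (s : ℝ) : jumpL l θ s ∈ gapCompl l θ := by
  rintro n m ⟨h1, h2⟩
  rw [leftEnd_add] at h1
  rw [← hl.jumpR_orbit hθ] at h2
  have h3 := hl.jumpL_strictMono.lt_iff_lt.1 h1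
  exact (h2.trans (hl.jumpR_lt_jumpL h3)).false

omit hl in
lemma exists_orbit_mem_Ioo (s : ℝ) {u v : ℝ} (huv : u < v) :
    ∃ n m : ℤ, s + n * θ + m ∈ Ioo u v := by
  have hd : Dense (AddSubgroup.closure {1, θ} : Set ℝ) :=
    dense_addSubgroupClosure_pair_iff.2 (by simpa using hθ)
  obtain ⟨x, hx, hx'⟩ := hd.exists_between (show u - s < v - s by linarith)
  obtain ⟨m, n, rfl⟩ := AddSubgroup.mem_closure_pair.1 hx
  simp only [zsmul_eq_mul, mul_one] at hx'
  exact ⟨n, m, by linarith [hx'.1], by linarith [hx'.2]⟩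

end IsGapSeq

/-! ### Bump profiles and functions of the fractional part -/

/-- A nonnegative `C¹` function `b` supported in the unit interval, bounded by `M`, with a
primitive `B` going from `0` to `1`. -/
structure IsUnitProfile (b B : ℝ → ℝ) (M : ℝ) : Prop where
  contDiff : ContDiff ℝ 1 b
  eq_zero : ∀ u, u ∉ Ioo (0:ℝ) 1 → b u = 0
  nonneg : ∀ u, 0 ≤ b u
  le : ∀ u, b u ≤ M
  hasDerivAt : ∀ u, HasDerivAt B (b u) u
  prim_zero : ∀ u ≤ 0, B u = 0
  prim_one : ∀ u, 1 ≤ u → B u = 1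

/-- A unit mass bump whose plateau has length `1 / M` has height at most `M`. Taking `M` close to 1
is what later keeps `1 + q` positive. -/
lemma exists_isUnitProfile {M : ℝ} (hM : 1 < M) : ∃ b B, IsUnitProfile b B M := by
  have h0 : 0 < 1 / M := by positivity
  have h1 : 1 / M < 1 := by rw [div_lt_one (by linarith)]; exact hM
  let f : ContDiffBump (1 / 2 : ℝ) := ⟨1 / (2 * M), 1 / 2, by positivity, by
    rw [show 1 / (2 * M) = 1 / 2 * (1 / M) by field_simp]; linarith⟩
  set b := f.normed MeasureTheory.volume with hb
  have hsupp : Function.support b = Ioo 0 1 := by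
    rw [hb, f.support_normed_eq, Real.ball_eq_Ioo]; norm_num [f]
  have hz : ∀ u, u ∉ Ioo (0:ℝ) 1 → b u = 0 := fun u hu => by
    rw [← hsupp, Function.notMem_support] at hu; exact hu
  have hcont : Continuous b := f.continuous_normed
  have hval : ∀ x y : ℝ, (∀ u, u ∈ Ioo x y → u ∉ Ioo (0:ℝ) 1) → x ≤ y →
      ∫ t in x..y, b t = 0 := fun x y h hxy => by
    rw [intervalIntegral.integral_of_le hxy, MeasureTheory.integral_Ioc_eq_integral_Ioo]
    exact MeasureTheory.setIntegral_eq_zero_of_forall_eq_zero fun u hu => hz u (h u hu)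
  refine ⟨b, fun u => ∫ t in (0:ℝ)..u, b t, f.contDiff_normed, hz, fun u => f.nonneg_normed u,
    fun u => ?_, fun u => ?_, fun u hu => ?_, fun u hu => ?_⟩
  · refine (f.normed_le_div_measure_closedBall_rIn MeasureTheory.volume u).trans (le_of_eq ?_)
    rw [Real.volume_real_closedBall f.rIn_pos.le]
    simp only [f]
    field_simp
  · exact intervalIntegral.integral_hasDerivAt_right (hcont.intervalIntegrable _ _)
      (hcont.stronglyMeasurableAtFilter _ _) hcont.continuousAt
  · rw [intervalIntegral.integral_symm, hval u 0 (fun v hv h => by linarith [hv.2, h.1]) hu,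
      neg_zero]
  · rw [← intervalIntegral.integral_add_adjacent_intervals (hcont.intervalIntegrable 0 1)
      (hcont.intervalIntegrable 1 u), hval 1 u (fun v hv h => by linarith [hv.1, h.2]) hu,
      add_zero, intervalIntegral.integral_of_le zero_le_one,
      MeasureTheory.setIntegral_eq_integral_of_forall_compl_eq_zero
        (fun x hx => hz x fun h => hx (Ioo_subset_Ioc_self h))]
    exact f.integral_normed

lemma exists_bound_of_eq_zero_off {c : ℝ → ℝ} (hc : Continuous c)
    (h0 : ∀ u, u ∉ Ioo (0:ℝ) 1 → c u = 0) : ∃ M, 0 ≤ M ∧ ∀ u, |c u| ≤ M := by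
  obtain ⟨M, hM⟩ := isCompact_Icc.exists_bound_of_continuousOn (s := Icc (0:ℝ) 1) hc.continuousOn
  refine ⟨M, (norm_nonneg _).trans (hM 0 (by simp)), fun u => ?_⟩
  by_cases hu : u ∈ Ioo (0:ℝ) 1
  · exact hM u (Ioo_subset_Icc_self hu)
  · rw [h0 u hu, abs_zero]; exact (norm_nonneg _).trans (hM 0 (by simp))

lemma deriv_eq_zero_off {c c' : ℝ → ℝ} (h0 : ∀ u, u ∉ Ioo (0:ℝ) 1 → c u = 0)
    (hc : ∀ u, HasDerivAt c (c' u) u) (u : ℝ) (hu : u ∉ Ioo (0:ℝ) 1) : c' u = 0 := by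
  rcases le_or_gt u 0 with h | h
  · have h1 : HasDerivWithinAt c 0 (Iic u) u :=
      (hasDerivWithinAt_const u _ (0:ℝ)).congr
        (fun v hv => h0 v fun hv' => by linarith [hv'.1, mem_Iic.1 hv]) (h0 u hu)
    exact (uniqueDiffWithinAt_Iic u).eq_deriv _ (hc u).hasDerivWithinAt h1
  · have h' : 1 ≤ u := by
      by_contra! h2; exact hu ⟨h, h2⟩
    have h1 : HasDerivWithinAt c 0 (Ici u) u :=
      (hasDerivWithinAt_const u _ (0:ℝ)).congr
        (fun v hv => h0 v fun hv' => by linarith [hv'.2, mem_Ici.1 hv]) (h0 u hu)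
    exact (uniqueDiffWithinAt_Ici u).eq_deriv _ (hc u).hasDerivWithinAt h1

/-- A function of the fractional part whose values match near the integers is locally a
function of the real variable. -/
lemma eventually_comp_fract {g : ℝ → ℝ} {δ : ℝ} (hδ0 : 0 < δ) (hδ1 : δ ≤ 1)
    (hg : ∀ u ∈ Ioo (-δ) 0, g (u + 1) = g u) (a x : ℝ) :
    ∀ᶠ y in 𝓝 x, g (Int.fract (y - a)) = g (y - a - ⌊x - a⌋) := by
  have h1 := Int.floor_le (x - a)
  have h2 := Int.lt_floor_add_one (x - a)
  filter_upwards [Ioo_mem_nhds (show a + ⌊x - a⌋ - δ < x by linarith)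
    (show x < a + ⌊x - a⌋ + 1 by linarith)] with y hy
  rcases le_or_gt (⌊x - a⌋ : ℝ) (y - a) with h | h
  · have : ⌊y - a⌋ = ⌊x - a⌋ := Int.floor_eq_iff.2 ⟨h, by linarith [hy.2]⟩
    rw [Int.fract, this]
  · have : ⌊y - a⌋ = ⌊x - a⌋ - 1 := Int.floor_eq_iff.2 ⟨by push_cast; linarith [hy.1],
      by push_cast; linarith⟩
    rw [Int.fract, this]
    push_cast
    rw [show y - a - (⌊x - a⌋ - 1) = y - a - ⌊x - a⌋ + 1 by ring]
    exact hg _ ⟨by linarith [hy.1], by linarith⟩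

lemma hasDerivAt_comp_fract {g g' : ℝ → ℝ} {δ : ℝ} (hδ0 : 0 < δ) (hδ1 : δ ≤ 1)
    (hg : ∀ u ∈ Ioo (-δ) 0, g (u + 1) = g u) (hd : ∀ u, HasDerivAt g (g' u) u) (a x : ℝ) :
    HasDerivAt (fun y => g (Int.fract (y - a))) (g' (Int.fract (x - a))) x := by
  have h : HasDerivAt (fun y => g (y - a - ⌊x - a⌋)) (g' (x - a - ⌊x - a⌋)) x := by
    simp only [sub_sub _ a]
    exact (hd (x - (a + ⌊x - a⌋))).comp_sub_const x (a + ⌊x - a⌋)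
  exact h.congr_of_eventuallyEq (eventually_comp_fract hδ0 hδ1 hg a x)

/-! ### Sums of rescaled bumps over the gaps -/

namespace IsGapSeq

variable {l : ℤ → ℝ} (hl : IsGapSeq l) {θ : ℝ} (hθ : Irrational θ)

/-- The sum over all gaps of a rescaled copy of `c` with amplitude `κ n` on the `n`-th gap. -/
noncomputable def gapSum (l : ℤ → ℝ) (θ : ℝ) (κ : ℤ → ℝ) (c : ℝ → ℝ) (x : ℝ) : ℝ :=
  ∑' n : ℤ, κ n * c (Int.fract (x - leftEnd l θ n) / l n)

include hl in
lemma mem_gap_of_fract_mem {x : ℝ} {n : ℤ} (h : Int.fract (x - leftEnd l θ n) / l n ∈ Ioo (0:ℝ) 1) :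
    x ∈ Ioo (leftEnd l θ n + ⌊x - leftEnd l θ n⌋)
      (leftEnd l θ n + ⌊x - leftEnd l θ n⌋ + l n) := by
  have hp := hl.pos n
  rw [mem_Ioo, lt_div_iff₀ hp, div_lt_iff₀ hp, zero_mul, one_mul, Int.fract] at h
  constructor <;> linarith [h.1, h.2]

include hl hθ

lemma exists_index (x : ℝ) :
    ∃ n, ∀ n', n' ≠ n → Int.fract (x - leftEnd l θ n') / l n' ∉ Ioo (0:ℝ) 1 := by
  by_cases h : ∃ n, Int.fract (x - leftEnd l θ n) / l n ∈ Ioo (0:ℝ) 1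
  · obtain ⟨n, hn⟩ := h
    refine ⟨n, fun n' hne hn' => hne ?_⟩
    exact (hl.eq_of_mem_gaps hθ (Ioo_subset_Icc_self (hl.mem_gap_of_fract_mem hn'))
      (Ioo_subset_Icc_self (hl.mem_gap_of_fract_mem hn))).1
  · push Not at h
    exact ⟨0, fun n' _ => h n'⟩

omit hl hθ in
lemma gapSum_eq_of_index {x : ℝ} {n : ℤ}
    (hn : ∀ n', n' ≠ n → Int.fract (x - leftEnd l θ n') / l n' ∉ Ioo (0:ℝ) 1)
    {c : ℝ → ℝ} (hc : ∀ u, u ∉ Ioo (0:ℝ) 1 → c u = 0) (κ : ℤ → ℝ) :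
    gapSum l θ κ c x = κ n * c (Int.fract (x - leftEnd l θ n) / l n) :=
  tsum_eq_single n fun n' hne => by rw [hc _ (hn n' hne), mul_zero]

lemma gapSum_sq {c : ℝ → ℝ} (hc : ∀ u, u ∉ Ioo (0:ℝ) 1 → c u = 0) (κ : ℤ → ℝ) (x : ℝ) :
    gapSum l θ κ c x ^ 2 = gapSum l θ (fun n => κ n ^ 2) (fun u => c u ^ 2) x := by
  obtain ⟨n, hn⟩ := hl.exists_index hθ x
  rw [gapSum_eq_of_index hn hc, gapSum_eq_of_index hn (fun u hu => by simp [hc u hu]), mul_pow]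

lemma gapSum_eq_on_gap {c : ℝ → ℝ} (hc : ∀ u, u ∉ Ioo (0:ℝ) 1 → c u = 0) (κ : ℤ → ℝ)
    {n m : ℤ} {x : ℝ} (hx : x ∈ Icc (leftEnd l θ n + m) (leftEnd l θ n + m + l n)) :
    gapSum l θ κ c x = κ n * c ((x - leftEnd l θ n - m) / l n) := by
  rw [gapSum_eq_of_index (n := n) (fun n' hne hn' => hne ?_) hc]
  · have : ⌊x - leftEnd l θ n⌋ = m :=
      Int.floor_eq_iff.2 ⟨by linarith [hx.1], by linarith [hx.2, hl.lt_one n]⟩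
    rw [Int.fract, this]
  · exact (hl.eq_of_mem_gaps hθ (Ioo_subset_Icc_self (hl.mem_gap_of_fract_mem hn')) hx).1

lemma gapSum_eq_zero {c : ℝ → ℝ} (hc : ∀ u, u ∉ Ioo (0:ℝ) 1 → c u = 0) (κ : ℤ → ℝ)
    {x : ℝ} (hx : x ∈ gapCompl l θ) : gapSum l θ κ c x = 0 := by
  obtain ⟨n, hn⟩ := hl.exists_index hθ x
  rw [gapSum_eq_of_index hn hc, hc _ fun h => hx n _ (hl.mem_gap_of_fract_mem h), mul_zero]

/-- The bumps have disjoint supports, so the error at any point is at most a single term. Hence `κ →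
0` suffices, without summability. -/
lemma tendstoUniformly_gapSum {c : ℝ → ℝ} (hcc : Continuous c)
    (hc : ∀ u, u ∉ Ioo (0:ℝ) 1 → c u = 0) {κ : ℤ → ℝ} (hκ : Tendsto κ cofinite (𝓝 0)) :
    TendstoUniformly (fun (F : Finset ℤ) x =>
      ∑ n ∈ F, κ n * c (Int.fract (x - leftEnd l θ n) / l n)) (gapSum l θ κ c) atTop := by
  obtain ⟨M, hM0, hM⟩ := exists_bound_of_eq_zero_off hcc hc
  rw [Metric.tendstoUniformly_iff]
  intro ε hε
  have hev : ∀ᶠ n in cofinite, |κ n| < ε / (M + 1) := by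
    have := Metric.tendsto_nhds.1 hκ (ε / (M + 1)) (by positivity)
    simpa [Real.dist_eq] using this
  rw [eventually_cofinite] at hev
  filter_upwards [eventually_ge_atTop hev.toFinset] with F hF x
  obtain ⟨n, hn⟩ := hl.exists_index hθ x
  rw [gapSum_eq_of_index hn hc, Real.dist_eq]
  by_cases hnF : n ∈ F
  · rw [Finset.sum_eq_single_of_mem n hnF fun n' _ hne => by rw [hc _ (hn n' hne), mul_zero],
      sub_self, abs_zero]
    exact hε
  · rw [Finset.sum_eq_zero fun n' hn' => by
      rw [hc _ (hn n' fun h => hnF (h ▸ hn')), mul_zero], sub_zero, abs_mul]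
    have h1 : |κ n| < ε / (M + 1) := by
      by_contra h; exact hnF (hF (by simpa using h))
    rw [lt_div_iff₀ (by positivity)] at h1
    nlinarith [hM (Int.fract (x - leftEnd l θ n) / l n), abs_nonneg (κ n)]

omit hθ in
lemma continuous_gapTerm {c : ℝ → ℝ} (hcc : Continuous c)
    (hc : ∀ u, u ∉ Ioo (0:ℝ) 1 → c u = 0) (n : ℤ) :
    Continuous (fun x => c (Int.fract (x - leftEnd l θ n) / l n)) := by
  have hp := hl.pos n
  have hlt := hl.lt_one n
  refine continuous_iff_continuousAt.2 fun x => ?_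
  -- The rescaled bump is zero both on `[l n, 1)` and below 0, so its values match across the
  -- integers on a margin of width `1 - l n`.
  have hev := eventually_comp_fract (g := fun u => c (u / l n)) (δ := 1 - l n) (by linarith)
    (by linarith) (fun u hu => by
      rw [hc _ fun h => by linarith [(div_lt_one hp).1 h.2, hu.1],
        hc _ fun h => by linarith [(div_pos_iff_of_pos_right hp).1 h.1, hu.2]])
    (leftEnd l θ n) x
  exact ContinuousAt.congr (by fun_prop) (hev.mono fun y hy => hy.symm)

lemma continuous_gapSum {c : ℝ → ℝ} (hcc : Continuous c)
    (hc : ∀ u, u ∉ Ioo (0:ℝ) 1 → c u = 0) {κ : ℤ → ℝ} (hκ : Tendsto κ cofinite (𝓝 0)) :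
    Continuous (gapSum l θ κ c) :=
  (hl.tendstoUniformly_gapSum hθ hcc hc hκ).continuous (Frequently.of_forall fun F =>
    continuous_finsetSum F fun n _ => continuous_const.mul (hl.continuous_gapTerm hcc hc n))

/-- Differentiation divides amplitudes by `l n`. This is meant for `κ n = relIncr l n ^ 2`; decay of
`relIncr l n / l n` is not available for the bump sum itself. -/
lemma hasDerivAt_gapSum {c c' : ℝ → ℝ} (hd : ∀ u, HasDerivAt c (c' u) u) (hcc : Continuous c')
    (hc : ∀ u, u ∉ Ioo (0:ℝ) 1 → c u = 0) {κ : ℤ → ℝ} (hκ : Tendsto κ cofinite (𝓝 0))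
    (hκ' : Tendsto (fun n => κ n / l n) cofinite (𝓝 0)) (x : ℝ) :
    HasDerivAt (gapSum l θ κ c) (gapSum l θ (fun n => κ n / l n) c' x) x := by
  have hc' := deriv_eq_zero_off hc hd
  have hcont : Continuous c := continuous_iff_continuousAt.2 fun u => (hd u).continuousAt
  refine hasDerivAt_of_tendstoUniformly (hl.tendstoUniformly_gapSum hθ hcc hc' hκ')
    (Eventually.of_forall fun F x => ?_)
    (fun x => (hl.tendstoUniformly_gapSum hθ hcont hc hκ).tendsto_at x) x
  refine HasDerivAt.fun_sum fun n _ => ?_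
  have hp := hl.pos n
  have hlt := hl.lt_one n
  have h1 := hasDerivAt_comp_fract (g := fun u => c (u / l n)) (g' := fun u => c' (u / l n) / l n)
    (δ := 1 - l n) (by linarith) (by linarith) (fun u hu => by
      rw [hc _ fun h => by linarith [(div_lt_one hp).1 h.2, hu.1],
        hc _ fun h => by linarith [(div_pos_iff_of_pos_right hp).1 h.1, hu.2]])
    (fun u => by
      have := (hd (u / l n)).comp u ((hasDerivAt_id u).div_const (l n))
      simpa [Function.comp_def, div_eq_mul_inv] using this) (leftEnd l θ n) x
  refine (h1.const_mul (κ n)).congr_deriv ?_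
  ring

end IsGapSeq

/-! ### The displacement of the Denjoy map -/

/-- `x ↦ x + ψ x` is the lift of a circle diffeomorphism of class `C^{1+α}` for all `α < 1`
whose derivative is `1 + q ≥ ε`, with `q ^ 2` of class `C¹`. -/
structure IsDisplacement (ψ q : ℝ → ℝ) (ε : ℝ) : Prop where
  eps_pos : 0 < ε
  eps_le : ε ≤ 1
  hasDerivAt : ∀ x, HasDerivAt ψ (q x) x
  periodic : ∀ x, ψ (x + 1) = ψ x
  le : ∀ x, ε - 1 ≤ q x
  continuous : Continuous q
  contDiff_sq : ContDiff ℝ 1 (fun x => q x ^ 2)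
  holder : ∀ α : ℝ≥0, 0 < α → α < 1 → ∃ C : ℝ≥0, HolderWith C α q

lemma HolderWith.of_dist_le {X Y : Type*} [PseudoMetricSpace X] [PseudoMetricSpace Y]
    {C : ℝ} (hC : 0 ≤ C) {α : ℝ≥0} {f : X → Y}
    (h : ∀ x y, dist (f x) (f y) ≤ C * dist x y ^ (α : ℝ)) : HolderWith C.toNNReal α f := by
  intro x y
  rw [edist_dist, edist_dist, ENNReal.ofReal_rpow_of_nonneg dist_nonneg α.coe_nonneg,
    ← ENNReal.ofReal_coe_nnreal, Real.coe_toNNReal _ hC, ← ENNReal.ofReal_mul hC]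
  exact ENNReal.ofReal_le_ofReal (h x y)

namespace IsGapSeq

variable {l : ℤ → ℝ} (hl : IsGapSeq l) {θ : ℝ} (hθ : Irrational θ)

include hl

lemma relIncr_tendsto : Tendsto (relIncr l) cofinite (𝓝 0) := by
  have := hl.tendsto 0 le_rfl one_pos
  simp only [Real.rpow_zero, div_one] at this
  exact (tendsto_zero_iff_abs_tendsto_zero _).2 this

/-- This is the decay condition with exponent 1/2, squared. -/
lemma relIncr_sq_div_tendsto : Tendsto (fun n => relIncr l n ^ 2 / l n) cofinite (𝓝 0) := by
  have := (hl.tendsto (1 / 2) (by norm_num) (by norm_num)).pow 2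
  refine (this.congr fun n => ?_).trans (by simp)
  rw [div_pow, sq_abs, ← Real.sqrt_eq_rpow, Real.sq_sqrt (hl.pos n).le]

lemma mul_relIncr (n : ℤ) : l n * relIncr l n = l (n + 1) - l n := by
  have := (hl.pos n).ne'
  unfold relIncr; field_simp

lemma summable_succ : Summable (fun n => l (n + 1)) :=
  (Equiv.addRight (1:ℤ)).summable_iff.2 hl.summable

lemma hasSum_incr : HasSum (fun n => l (n + 1) - l n) 0 := by
  have h : ∑' n, l (n + 1) = ∑' n, l n := (Equiv.addRight (1:ℤ)).tsum_eq l
  have := hl.summable_succ.hasSum.sub hl.summable.hasSum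
  rwa [h, sub_self] at this

lemma summable_incr_mul {u : ℤ → ℝ} {M : ℝ} (hu : ∀ n, |u n| ≤ M) :
    Summable (fun n => (l (n + 1) - l n) * u n) := by
  refine Summable.of_norm_bounded ((hl.summable_succ.add hl.summable).mul_right M) fun n => ?_
  rw [Real.norm_eq_abs, abs_mul]
  refine mul_le_mul ?_ (hu n) (abs_nonneg _) (add_pos (hl.pos _) (hl.pos _)).le
  rw [abs_le]
  constructor <;> linarith [hl.pos (n + 1), hl.pos n]

omit hl in
lemma _root_.IsUnitProfile.prim_mem {b B : ℝ → ℝ} {M : ℝ} (hb : IsUnitProfile b B M) (u : ℝ) :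
    B u ∈ Icc (0:ℝ) 1 := by
  have hm : Monotone B := monotone_of_hasDerivAt_nonneg hb.hasDerivAt hb.nonneg
  constructor
  · rw [← hb.prim_zero (min u 0) (min_le_right _ _)]; exact hm (min_le_left _ _)
  · rw [← hb.prim_one (max u 1) (le_max_right _ _)]; exact hm (le_max_left _ _)

/-- The contribution of the `n`-th gap to the displacement. -/
noncomputable def gapStep (l : ℤ → ℝ) (θ : ℝ) (B : ℝ → ℝ) (n : ℤ) (x : ℝ) : ℝ :=
  B (Int.fract (x - leftEnd l θ n) / l n) - Int.fract (x - leftEnd l θ n)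

omit hl in
lemma abs_gapStep_le {b B : ℝ → ℝ} {M : ℝ} (hb : IsUnitProfile b B M) (n : ℤ) (x : ℝ) :
    |gapStep l θ B n x| ≤ 1 := by
  have h1 := hb.prim_mem (Int.fract (x - leftEnd l θ n) / l n)
  have h2 := Int.fract_nonneg (x - leftEnd l θ n)
  have h3 := Int.fract_lt_one (x - leftEnd l θ n)
  rw [abs_le]
  unfold gapStep
  constructor <;> linarith [h1.1, h1.2]

lemma hasDerivAt_gapStep {b B : ℝ → ℝ} {M : ℝ} (hb : IsUnitProfile b B M) (n : ℤ) (x : ℝ) :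
    HasDerivAt (gapStep l θ B n) (b (Int.fract (x - leftEnd l θ n) / l n) / l n - 1) x := by
  have hp := hl.pos n
  have hlt := hl.lt_one n
  refine hasDerivAt_comp_fract (g := fun u => B (u / l n) - u) (g' := fun u => b (u / l n) / l n - 1)
    (δ := 1 - l n) (by linarith) (by linarith) (fun u hu => ?_) (fun u => ?_) (leftEnd l θ n) x
  · rw [hb.prim_one _ ((one_le_div hp).2 (by linarith [hu.1])),
      hb.prim_zero (u / l n) (div_nonpos_of_nonpos_of_nonneg hu.2.le hp.le)]
    ring
  · have := (hb.hasDerivAt (u / l n)).comp u ((hasDerivAt_id u).div_const (l n))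
    simpa [Function.comp_def, div_eq_mul_inv] using this.fun_sub (hasDerivAt_id' u)

include hθ

/-- Subtracting the fractional part makes `gapStep` match across the integers, at the price of a
term `-1` in its derivative. These terms add up to `-∑ (l (n + 1) - l n) = 0`, by shift invariance,
and only the bumps survive. -/
lemma hasDerivAt_tsum_gapStep {b B : ℝ → ℝ} {M : ℝ} (hb : IsUnitProfile b B M) (x : ℝ) :
    HasDerivAt (fun x => ∑' n, (l (n + 1) - l n) * gapStep l θ B n x)
      (gapSum l θ (relIncr l) b x) x := by
  have hu := hl.tendstoUniformly_gapSum hθ hb.contDiff.continuous hb.eq_zero hl.relIncr_tendsto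
  have h0 : TendstoUniformly (fun (F : Finset ℤ) (_ : ℝ) => ∑ n ∈ F, (l (n + 1) - l n))
      (fun _ => 0) atTop := by
    rw [Metric.tendstoUniformly_iff]
    intro ε hε
    filter_upwards [Metric.tendsto_nhds.1 hl.hasSum_incr ε hε] with F hF x
    rwa [dist_comm]
  have hs := hu.sub h0
  rw [show (gapSum l θ (relIncr l) b - fun _ => (0:ℝ)) = gapSum l θ (relIncr l) b by
    ext; simp] at hs
  refine hasDerivAt_of_tendstoUniformly (f := fun (F : Finset ℤ) x =>
      ∑ n ∈ F, (l (n + 1) - l n) * gapStep l θ B n x) hs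
    (Eventually.of_forall fun F x => ?_)
    (fun x => (hl.summable_incr_mul fun n => abs_gapStep_le hb n x).hasSum) x
  refine (HasDerivAt.fun_sum fun n _ =>
    (hl.hasDerivAt_gapStep (θ := θ) hb n x).const_mul (l (n + 1) - l n)).congr_deriv ?_
  simp only [Pi.sub_apply]
  rw [← Finset.sum_sub_distrib]
  refine Finset.sum_congr rfl fun n _ => ?_
  have := (hl.pos n).ne'
  rw [← hl.mul_relIncr]
  field_simp

/-- On the image of the semiconjugacy the primitive `B` is either complete, with value 1, or the
point is the left end of a translate of the gap, where `B` and the fractional part both vanish. The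
two cases give the same formula. -/
lemma gapStep_jumpL {b B : ℝ → ℝ} {M : ℝ} (hb : IsUnitProfile b B M) (n : ℤ) (s : ℝ) :
    gapStep l θ B n (jumpL l θ s) = ⌈s - n * θ⌉ - jumpL l θ s + leftEnd l θ n := by
  have h := hl.jumpL_mem_Icc hθ n s
  set j := ⌈s - n * θ⌉
  have hp := hl.pos n
  unfold gapStep
  rcases h.2.lt_or_eq with h1 | h1
  · have : ⌊jumpL l θ s - leftEnd l θ n⌋ = j - 1 :=
      Int.floor_eq_iff.2 ⟨by push_cast; linarith [h.1], by push_cast; linarith⟩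
    rw [Int.fract, this, hb.prim_one _ ((one_le_div hp).2 (by push_cast; exact h.1))]
    push_cast; ring
  · have : jumpL l θ s - leftEnd l θ n = j := by linarith
    rw [this, Int.fract_intCast, zero_div, hb.prim_zero 0 le_rfl]
    linarith

omit hθ in
-- Reindexing by one moves the rotation from the arguments to the coefficients.
lemma jumpL_add_rotation (s : ℝ) :
    jumpL l θ (s + θ) = jumpL l θ s + θ
      + ∑' n : ℤ, (l (n + 1) - l n) * (⌈s - n * θ⌉ - (s - n * θ)) := by
  have h1 : ∑' n : ℤ, l n * (⌈s + θ - n * θ⌉ - (s + θ - n * θ))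
      = ∑' n : ℤ, l (n + 1) * (⌈s - n * θ⌉ - (s - n * θ)) := by
    rw [← (Equiv.addRight (1:ℤ)).tsum_eq]
    congr 1; ext n
    simp only [Equiv.coe_addRight]
    push_cast
    rw [show s + θ - (n + 1) * θ = s - n * θ by ring]
  have hb : ∀ n : ℤ, |(⌈s - n * θ⌉ : ℝ) - (s - n * θ)| ≤ 1 := fun n => by
    have := ceil_sub_mem (s - n * θ)
    rw [abs_of_nonneg this.1]; exact this.2
  have h2 := hl.summable_mul (fun n => ceil_sub_mem (s - n * θ))
  have h3 := (h2.tsum_add (hl.summable_incr_mul hb))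
  unfold jumpL
  rw [h1]
  have h4 : ∀ n : ℤ, l (n + 1) * ((⌈s - n * θ⌉ : ℝ) - (s - n * θ))
      = l n * (⌈s - n * θ⌉ - (s - n * θ)) + (l (n + 1) - l n) * (⌈s - n * θ⌉ - (s - n * θ)) :=
    fun n => by ring
  simp_rw [h4]
  rw [h3]
  ring

/-- Both sides contain the same series in `⌈s - n * θ⌉`. The part of `gapStep` independent of `n` is
killed because the increments sum to zero, and what is left does not depend on `s`; it fixes `c`. -/
lemma exists_tsum_gapStep_jumpL {b B : ℝ → ℝ} {M : ℝ} (hb : IsUnitProfile b B M) :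
    ∃ c : ℝ, ∀ s, ∑' n, (l (n + 1) - l n) * gapStep l θ B n (jumpL l θ s) + c + jumpL l θ s
      = jumpL l θ (s + θ) := by
  have hA : ∀ n : ℤ, |leftEnd l θ n - n * θ| ≤ 1 := fun n => by
    have := hl.jumpL_mem (θ := θ) (n * θ)
    rw [leftEnd, abs_of_nonneg] <;> linarith [this.1, this.2]
  have hC : ∀ (s : ℝ) (n : ℤ), |(⌈s - n * θ⌉ : ℝ) - (s - n * θ)| ≤ 1 := fun s n => by
    have := ceil_sub_mem (s - n * θ)
    rw [abs_of_nonneg this.1]; exact this.2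
  refine ⟨θ - ∑' n : ℤ, (l (n + 1) - l n) * (leftEnd l θ n - n * θ), fun s => ?_⟩
  rw [hl.jumpL_add_rotation]
  have h1 : ∀ n, (l (n + 1) - l n) * gapStep l θ B n (jumpL l θ s)
      = (l (n + 1) - l n) * (⌈s - n * θ⌉ - (s - n * θ))
        + (l (n + 1) - l n) * (leftEnd l θ n - n * θ)
        + (l (n + 1) - l n) * (s - jumpL l θ s) := fun n => by
    rw [hl.gapStep_jumpL hθ hb]; ring
  simp_rw [h1]
  rw [((hl.summable_incr_mul (hC s)).add (hl.summable_incr_mul hA)).tsum_add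
    (hl.hasSum_incr.summable.mul_right _),
    (hl.summable_incr_mul (hC s)).tsum_add (hl.summable_incr_mul hA), tsum_mul_right,
    hl.hasSum_incr.tsum_eq]
  ring

/-- Within one gap, the Lipschitz bound of `b` in the rescaled variable `t ≤ 1` and `t ≤ t ^ α` give
a constant governed by the supremum of `|relIncr l n| / l n ^ α`. Points not in a common gap are
compared through gap end points between them, where the sum vanishes; this costs a factor 2. -/
lemma exists_holderWith_gapSum {b B : ℝ → ℝ} {M : ℝ} (hb : IsUnitProfile b B M) {α : ℝ≥0}
    (hα1 : α < 1) :
    ∃ C : ℝ≥0, HolderWith C α (gapSum l θ (relIncr l) b) := by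
  set q := gapSum l θ (relIncr l) b with hq
  obtain ⟨C0, hC0⟩ := (hl.tendsto α α.coe_nonneg (by exact_mod_cast hα1)).bddAbove_range_of_cofinite
  have hC0' : ∀ n, |relIncr l n| / l n ^ (α : ℝ) ≤ C0 := fun n => hC0 ⟨n, rfl⟩
  obtain ⟨L, hL⟩ := exists_bound_of_eq_zero_off (hb.contDiff.continuous_deriv le_rfl)
    (deriv_eq_zero_off hb.eq_zero fun u =>
      ((hb.contDiff.differentiable one_ne_zero) u).hasDerivAt)
  have hLip : ∀ u v, |b u - b v| ≤ L * |u - v| := fun u v => by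
    have := Convex.norm_image_sub_le_of_norm_deriv_le (s := univ) (f := b) (C := L)
      (fun x _ => (hb.contDiff.differentiable one_ne_zero) x) (fun x _ => hL.2 x) convex_univ
      (mem_univ v) (mem_univ u)
    simpa using this
  have hC00 : 0 ≤ C0 :=
    (div_nonneg (abs_nonneg _) (Real.rpow_nonneg (hl.pos 0).le _)).trans (hC0' 0)
  set C := C0 * L with hC
  have hCnn : 0 ≤ C := mul_nonneg hC00 hL.1
  have same : ∀ (n m : ℤ) (x y : ℝ), x ∈ Icc (leftEnd l θ n + m) (leftEnd l θ n + m + l n) →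
      y ∈ Icc (leftEnd l θ n + m) (leftEnd l θ n + m + l n) →
      |q x - q y| ≤ C * |x - y| ^ (α : ℝ) := by
    intro n m x y hx hy
    have hp := hl.pos n
    rw [hq, hl.gapSum_eq_on_gap hθ hb.eq_zero _ hx, hl.gapSum_eq_on_gap hθ hb.eq_zero _ hy,
      ← mul_sub, abs_mul]
    have h1 := hLip ((x - leftEnd l θ n - m) / l n) ((y - leftEnd l θ n - m) / l n)
    rw [← sub_div, show x - leftEnd l θ n - m - (y - leftEnd l θ n - m) = x - y by ring, abs_div,
      abs_of_pos hp] at h1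
    have h2 : |x - y| / l n ≤ 1 := by
      rw [div_le_one hp, abs_le]; constructor <;> linarith [hx.1, hx.2, hy.1, hy.2]
    have h3 : |x - y| / l n ≤ (|x - y| / l n) ^ (α : ℝ) :=
      Real.self_le_rpow_of_le_one (by positivity) h2 (by exact_mod_cast hα1.le)
    rw [Real.div_rpow (abs_nonneg _) hp.le] at h3
    have h4 := hC0' n
    have hlα := Real.rpow_pos_of_pos hp (α : ℝ)
    calc |relIncr l n| * |b ((x - leftEnd l θ n - m) / l n) - b ((y - leftEnd l θ n - m) / l n)|
        ≤ |relIncr l n| * (L * (|x - y| ^ (α : ℝ) / l n ^ (α : ℝ))) := by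
          refine mul_le_mul_of_nonneg_left (h1.trans ?_) (abs_nonneg _)
          exact mul_le_mul_of_nonneg_left h3 hL.1
      _ = |relIncr l n| / l n ^ (α : ℝ) * (L * |x - y| ^ (α : ℝ)) := by field_simp
      _ ≤ C0 * (L * |x - y| ^ (α : ℝ)) :=
          mul_le_mul_of_nonneg_right h4 (mul_nonneg hL.1 (by positivity))
      _ = C * |x - y| ^ (α : ℝ) := by rw [hC]; ring
  have hzero : ∀ (n m : ℤ) (x : ℝ), x = leftEnd l θ n + m ∨ x = leftEnd l θ n + m + l n →
      q x = 0 := by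
    intro n m x hx
    have hp := hl.pos n
    rw [hq, hl.gapSum_eq_on_gap hθ hb.eq_zero (n := n) (m := m) _ (by
      rcases hx with rfl | rfl <;> constructor <;> linarith), hb.eq_zero, mul_zero]
    rcases hx with rfl | rfl
    · simp
    · rw [show leftEnd l θ n + m + l n - leftEnd l θ n - m = l n by ring, div_self hp.ne']
      simp
  have hgap : ∀ x, q x ≠ 0 → ∃ n m : ℤ, x ∈ Icc (leftEnd l θ n + m) (leftEnd l θ n + m + l n) := by
    intro x hx
    by_contra! h
    exact hx (hl.gapSum_eq_zero hθ hb.eq_zero _ fun n m hnm => h n m (Ioo_subset_Icc_self hnm))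
  have main : ∀ x y, x ≤ y → |q x - q y| ≤ 2 * C * |x - y| ^ (α : ℝ) := by
    intro x y hxy
    have hnn : 0 ≤ C * |x - y| ^ (α : ℝ) := mul_nonneg hCnn (by positivity)
    by_cases hs : ∃ n m : ℤ, x ∈ Icc (leftEnd l θ n + m) (leftEnd l θ n + m + l n) ∧
        y ∈ Icc (leftEnd l θ n + m) (leftEnd l θ n + m + l n)
    · obtain ⟨n, m, hx, hy⟩ := hs
      linarith [same n m x y hx hy]
    · push Not at hs
      have hx : |q x| ≤ C * |x - y| ^ (α : ℝ) := by
        by_cases h0 : q x = 0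
        · rwa [h0, abs_zero]
        · obtain ⟨n, m, hx⟩ := hgap x h0
          have hy : leftEnd l θ n + m + l n < y := by
            by_contra! h
            exact hs n m hx ⟨hx.1.trans hxy, h⟩
          have := same n m x (leftEnd l θ n + m + l n) hx ⟨by linarith [hl.pos n], le_rfl⟩
          rw [hzero n m _ (Or.inr rfl), sub_zero] at this
          refine this.trans (mul_le_mul_of_nonneg_left (Real.rpow_le_rpow (abs_nonneg _) ?_
            α.coe_nonneg) hCnn)
          rw [abs_of_nonpos (by linarith [hx.2]), abs_of_nonpos (by linarith)]
          linarith
      have hy : |q y| ≤ C * |x - y| ^ (α : ℝ) := by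
        by_cases h0 : q y = 0
        · rwa [h0, abs_zero]
        · obtain ⟨n, m, hy⟩ := hgap y h0
          have hx : x < leftEnd l θ n + m := by
            by_contra! h
            exact hs n m ⟨h, hxy.trans hy.2⟩ hy
          have := same n m y (leftEnd l θ n + m) hy ⟨le_rfl, by linarith [hl.pos n]⟩
          rw [hzero n m _ (Or.inl rfl), sub_zero] at this
          refine this.trans (mul_le_mul_of_nonneg_left (Real.rpow_le_rpow (abs_nonneg _) ?_
            α.coe_nonneg) hCnn)
          rw [abs_of_nonneg (by linarith [hy.1]), abs_of_nonpos (by linarith)]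
          linarith
      have := abs_sub (q x) (q y)
      linarith
  refine ⟨_, HolderWith.of_dist_le (C := 2 * C) (by positivity) fun x y => ?_⟩
  rw [Real.dist_eq, Real.dist_eq]
  rcases le_total x y with h | h
  · exact main x y h
  · rw [abs_sub_comm, abs_sub_comm x y]; exact main y x h

/-- The displacement of a Denjoy map with prescribed gap lengths. -/
theorem exists_isDisplacement :
    ∃ ψ q ε, IsDisplacement ψ q ε ∧ (∀ x ∈ gapCompl l θ, q x = 0) ∧
      ∀ s, jumpL l θ s + ψ (jumpL l θ s) = jumpL l θ (s + θ) := by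
  obtain ⟨ρ0, hρ0, hρ0'⟩ := hl.lower
  -- The cap ensures `1 - ρ ≥ 0`. With `0 ≤ b ≤ 1 + ρ / 2` this gives `relIncr l n * b ≥ -(1 - ρ) *
  -- (1 + ρ / 2) ≥ ρ / 2 - 1`, hence the choice `ε = ρ / 2`.
  set ρ := min ρ0 (1 / 2) with hρdef
  have hρ : 0 < ρ := lt_min hρ0 (by norm_num)
  have hρ1 : ρ ≤ 1 / 2 := min_le_right _ _
  have hρ' : ∀ n, ρ - 1 ≤ relIncr l n := fun n =>
    (sub_le_sub_right (min_le_left _ _) _).trans (hρ0' n)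
  obtain ⟨b, B, hb⟩ := exists_isUnitProfile (M := 1 + ρ / 2) (by linarith)
  obtain ⟨c, hc⟩ := hl.exists_tsum_gapStep_jumpL hθ hb
  have hbd : ∀ u, HasDerivAt b (deriv b u) u := fun u =>
    ((hb.contDiff.differentiable one_ne_zero) u).hasDerivAt
  refine ⟨fun x => ∑' n, (l (n + 1) - l n) * gapStep l θ B n x + c, gapSum l θ (relIncr l) b,
    ρ / 2, ⟨by linarith, by linarith, fun x => (hl.hasDerivAt_tsum_gapStep hθ hb x).add_const c,
      fun x => ?_, fun x => ?_, hl.continuous_gapSum hθ hb.contDiff.continuous hb.eq_zero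
        hl.relIncr_tendsto, ?_, fun α _ hα1 => hl.exists_holderWith_gapSum hθ hb hα1⟩,
    fun x hx => hl.gapSum_eq_zero hθ hb.eq_zero _ hx, fun s => by rw [← hc s]; ring⟩
  · have : ∀ n, gapStep l θ B n (x + 1) = gapStep l θ B n x := fun n => by
      unfold gapStep
      rw [show x + 1 - leftEnd l θ n = x - leftEnd l θ n + 1 by ring, Int.fract_add_one]
    simp only [this]
  · obtain ⟨n, hn⟩ := hl.exists_index hθ x
    rw [gapSum_eq_of_index hn hb.eq_zero]
    have h1 := hb.nonneg (Int.fract (x - leftEnd l θ n) / l n)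
    have h2 := hb.le (Int.fract (x - leftEnd l θ n) / l n)
    nlinarith [mul_le_mul_of_nonneg_right (hρ' n) h1,
      mul_le_mul_of_nonneg_left h2 (show 0 ≤ 1 - ρ by linarith)]
  · have h0 : ∀ u, u ∉ Ioo (0:ℝ) 1 → b u ^ 2 = 0 := fun u hu => by rw [hb.eq_zero u hu]; ring
    have hd : ∀ u, HasDerivAt (fun u => b u ^ 2) (2 * b u * deriv b u) u := fun u => by
      simpa using (hbd u).fun_pow 2
    have hcc : Continuous (fun u => 2 * b u * deriv b u) :=
      (continuous_const.mul hb.contDiff.continuous).mul (hb.contDiff.continuous_deriv le_rfl)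
    have hκ : Tendsto (fun n => relIncr l n ^ 2) cofinite (𝓝 0) := by
      simpa using hl.relIncr_tendsto.pow 2
    have hD := hl.hasDerivAt_gapSum hθ hd hcc h0 hκ hl.relIncr_sq_div_tendsto
    have heq : (fun x => gapSum l θ (relIncr l) b x ^ 2)
        = gapSum l θ (fun n => relIncr l n ^ 2) (fun u => b u ^ 2) :=
      funext fun x => hl.gapSum_sq hθ hb.eq_zero _ x
    rw [heq, contDiff_one_iff_deriv]
    refine ⟨fun x => (hD x).differentiableAt, ?_⟩
    rw [funext fun x => (hD x).deriv]
    exact hl.continuous_gapSum hθ hcc (deriv_eq_zero_off h0 hd) hl.relIncr_sq_div_tendsto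

end IsGapSeq

/-! ### Plane calculus for expressions `q ^ 2 U(q, y)` -/

/-- The linear form on the plane with coefficients `u` and `v`. -/
noncomputable def planeForm (u v : ℝ) : ℝ × ℝ →L[ℝ] ℝ :=
  u • ContinuousLinearMap.fst ℝ ℝ ℝ + v • ContinuousLinearMap.snd ℝ ℝ ℝ

@[simp] lemma planeForm_apply (u v : ℝ) (w : ℝ × ℝ) : planeForm u v w = u * w.1 + v * w.2 := by
  simp [planeForm]

lemma planeForm_eta (L : ℝ × ℝ →L[ℝ] ℝ) : L = planeForm (L (1, 0)) (L (0, 1)) := by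
  refine ContinuousLinearMap.ext fun w => ?_
  have h : w = w.1 • ((1, 0) : ℝ × ℝ) + w.2 • ((0, 1) : ℝ × ℝ) := by ext <;> simp
  conv_lhs => rw [h, map_add, map_smul, map_smul]
  simp [mul_comm]

lemma contDiff_planeForm {n : WithTop ℕ∞} {u v : ℝ × ℝ → ℝ} (hu : ContDiff ℝ n u)
    (hv : ContDiff ℝ n v) : ContDiff ℝ n (fun p => planeForm (u p) (v p)) :=
  (hu.smul contDiff_const).add (hv.smul contDiff_const)

lemma contDiff_one_of_planeForm {f u v : ℝ × ℝ → ℝ} (hu : Continuous u) (hv : Continuous v)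
    (h : ∀ p, HasFDerivAt f (planeForm (u p) (v p)) p) : ContDiff ℝ 1 f :=
  contDiff_one_iff_hasFDerivAt.2 ⟨_, contDiff_zero.1
    (contDiff_planeForm (contDiff_zero.2 hu) (contDiff_zero.2 hv)), h⟩

lemma contDiff_two_of_planeForm {f u v : ℝ × ℝ → ℝ} (hu : ContDiff ℝ 1 u) (hv : ContDiff ℝ 1 v)
    (h : ∀ p, HasFDerivAt f (planeForm (u p) (v p)) p) : ContDiff ℝ 2 f := by
  have := (contDiff_succ_iff_hasFDerivAt (𝕜 := ℝ) (n := 1) (f := f)).2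
    ⟨_, contDiff_planeForm (n := ((1:ℕ) : WithTop ℕ∞)) (by simpa using hu) (by simpa using hv), h⟩
  rwa [Nat.cast_one, one_add_one_eq_two] at this

lemma HasDerivAt.hasFDerivAt_comp_fst {g : ℝ → ℝ} {g' : ℝ} {p : ℝ × ℝ} (h : HasDerivAt g g' p.1) :
    HasFDerivAt (fun p : ℝ × ℝ => g p.1) (planeForm g' 0) p := by
  refine (h.comp_hasFDerivAt p (hasFDerivAt_fst (𝕜 := ℝ) (p := p))).congr_fderiv ?_
  ext <;> simp

lemma HasDerivAt.hasFDerivAt_comp_snd {g : ℝ → ℝ} {g' : ℝ} {p : ℝ × ℝ} (h : HasDerivAt g g' p.2) :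
    HasFDerivAt (fun p : ℝ × ℝ => g p.2) (planeForm 0 g') p := by
  refine (h.comp_hasFDerivAt p (hasFDerivAt_snd (𝕜 := ℝ) (p := p))).congr_fderiv ?_
  ext <;> simp

/-- Differentiation under the integral sign for a parametric primitive. -/
lemma hasFDerivAt_parametric_primitive {w w' : ℝ × ℝ → ℝ} (hw : Continuous w) (hw' : Continuous w')
    (hd : ∀ z y, HasDerivAt (fun y => w (z, y)) (w' (z, y)) y) (p : ℝ × ℝ) :
    HasFDerivAt (fun p : ℝ × ℝ => ∫ t in (0:ℝ)..p.1, w (t, p.2))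
      (planeForm (w p) (∫ t in (0:ℝ)..p.1, w' (t, p.2))) p := by
  have hc : Continuous (fun p : ℝ × ℝ => ∫ t in (0:ℝ)..p.1, w' (t, p.2)) := by
    have := intervalIntegral.continuous_parametric_primitive_of_continuous (a₀ := (0:ℝ))
      (μ := MeasureTheory.volume) (f := fun y t => w' (t, y)) (by
        simp only [Function.uncurry_def]; fun_prop)
    exact this.comp continuous_swap
  -- Existence and continuity of both partial derivatives give joint differentiability.
  have key := hasStrictFDerivAt_uncurry_coprod (𝕜 := ℝ) (u := p)
    (f := fun z y => ∫ t in (0:ℝ)..z, w (t, y))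
    (f₁ := fun z y => ContinuousLinearMap.toSpanSingleton ℝ (w (z, y)))
    (f₂ := fun z y => ContinuousLinearMap.toSpanSingleton ℝ (∫ t in (0:ℝ)..z, w' (t, y)))
    (Eventually.of_forall fun v => ?_) (Eventually.of_forall fun v => ?_) ?_ ?_
  · refine key.hasFDerivAt.congr_fderiv ?_
    ext <;> simp [Function.HasUncurry.uncurry]
  · have : Continuous fun t => w (t, v.2) := by fun_prop
    exact (intervalIntegral.integral_hasDerivAt_right (this.intervalIntegrable _ _)
      (this.stronglyMeasurableAtFilter _ _) this.continuousAt).hasFDerivAt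
  · obtain ⟨C, hC⟩ := (isCompact_uIcc (a := (0:ℝ)) (b := v.1)).prod
      (isCompact_Icc (a := v.2 - 1) (b := v.2 + 1)) |>.exists_bound_of_continuousOn
      hw'.continuousOn
    have := (intervalIntegral.hasDerivAt_integral_of_dominated_loc_of_deriv_le (𝕜 := ℝ)
      (μ := MeasureTheory.volume) (a := 0) (b := v.1) (F := fun y t => w (t, y))
      (F' := fun y t => w' (t, y)) (x₀ := v.2) (s := Icc (v.2 - 1) (v.2 + 1)) (bound := fun _ => C)
      (Icc_mem_nhds (by linarith) (by linarith))
      (Eventually.of_forall fun y => (show Continuous fun t => w (t, y) by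
        fun_prop).aestronglyMeasurable)
      ((show Continuous fun t => w (t, v.2) by fun_prop).intervalIntegrable _ _)
      (show Continuous fun t => w' (t, v.2) by fun_prop).aestronglyMeasurable
      (Eventually.of_forall fun t ht y hy => hC (t, y) ⟨uIoc_subset_uIcc ht, hy⟩)
      intervalIntegrable_const
      (Eventually.of_forall fun t _ y _ => hd t y)).2
    exact this.hasFDerivAt
  · exact Continuous.continuousAt ((ContinuousLinearMap.toSpanSingletonCLE
      (𝕜 := ℝ) (E := ℝ)).continuous.comp hw)
  · exact Continuous.continuousAt ((ContinuousLinearMap.toSpanSingletonCLE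
      (𝕜 := ℝ) (E := ℝ)).continuous.comp hc)

lemma continuous_parametric_primitive {w : ℝ × ℝ → ℝ} (hw : Continuous w) :
    Continuous (fun p : ℝ × ℝ => ∫ t in (0:ℝ)..p.1, w (t, p.2)) := by
  have := intervalIntegral.continuous_parametric_primitive_of_continuous (a₀ := (0:ℝ))
    (μ := MeasureTheory.volume) (f := fun y t => w (t, y)) (by
      simp only [Function.uncurry_def]; fun_prop)
  exact this.comp continuous_swap

/-- If `q` is continuous with `q ^ 2` of class `C¹`, then so is `q ^ 2 U(q, y)` for `U` of
class `C¹`. -/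
lemma contDiff_sq_mul_comp {q : ℝ → ℝ} (hq : Continuous q) (hq2 : ContDiff ℝ 1 fun z => q z ^ 2)
    {U : ℝ × ℝ → ℝ} (hU : ∀ z y, ContDiffAt ℝ 1 U (q z, y)) :
    ContDiff ℝ 1 (fun p : ℝ × ℝ => q p.1 ^ 2 * U (q p.1, p.2)) := by
  set r := fun z => q z ^ 2 with hr
  have hrd : ∀ z, HasDerivAt r (deriv r z) z := fun z =>
    (hq2.differentiable one_ne_zero z).hasDerivAt
  have hrc : Continuous (deriv r) := hq2.continuous_deriv le_rfl
  have hm : Continuous fun p : ℝ × ℝ => (q p.1, p.2) := by fun_prop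
  have hUc : Continuous fun p : ℝ × ℝ => U (q p.1, p.2) := continuous_iff_continuousAt.2 fun p =>
    (hU p.1 p.2).continuousAt.comp (f := fun p : ℝ × ℝ => (q p.1, p.2)) hm.continuousAt
  have hUf : Continuous fun p : ℝ × ℝ => fderiv ℝ U (q p.1, p.2) :=
    continuous_iff_continuousAt.2 fun p =>
      ((hU p.1 p.2).continuousAt_fderiv one_ne_zero).comp (f := fun p : ℝ × ℝ => (q p.1, p.2))
        hm.continuousAt
  -- Formally `q ^ 2 q' = q r' / 2`, so the `z`-derivative is `r' (U + q U_s / 2)`, with `U_s` the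
  -- derivative of `U` in its first argument. This expression is continuous and no longer contains
  -- `q'`.
  refine contDiff_one_of_planeForm
    (u := fun p => deriv r p.1 * (U (q p.1, p.2) + q p.1 * fderiv ℝ U (q p.1, p.2) (1, 0) / 2))
    (v := fun p => q p.1 ^ 2 * fderiv ℝ U (q p.1, p.2) (0, 1)) 
    ((hrc.comp continuous_fst).mul (hUc.add (((hq.comp continuous_fst).mul
      (hUf.clm_apply continuous_const)).div_const 2)))
    (((hq.comp continuous_fst).pow 2).mul (hUf.clm_apply continuous_const)) fun p => ?_
  have hr1 := (hrd p.1).hasFDerivAt_comp_fst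
  by_cases h0 : q p.1 = 0
  -- At a zero of `q` the function `q ^ 2` is minimal, so `r` vanishes to first order there.
  -- Multiplication by the locally bounded factor `U` preserves this.
  · have hd0 : deriv r p.1 = 0 := by
      refine IsLocalMin.deriv_eq_zero (Eventually.of_forall fun z => ?_)
      rw [show r p.1 = 0 by simp [hr, h0]]
      exact sq_nonneg (q z)
    rw [hd0] at hr1
    simp only [hd0, h0, zero_mul, ne_eq, OfNat.ofNat_ne_zero, not_false_eq_true, zero_pow]
    rw [hasFDerivAt_iff_isLittleO] at hr1 ⊢
    have hO : (fun p : ℝ × ℝ => U (q p.1, p.2)) =O[𝓝 p] (fun _ => (1:ℝ)) :=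
      hUc.continuousAt.isBigO_one ℝ
    have := hr1.norm_right.mul_isBigO hO
    simp only [mul_one] at this
    replace this := this.of_norm_right
    have hz : planeForm 0 0 = 0 := by ext <;> simp
    simpa [hr, h0, hz] using this
  -- Off its zeros `q` has locally constant sign, so it is `±√r` and differentiable.
  · have hqd : HasDerivAt q (deriv r p.1 / (2 * q p.1)) p.1 := by
      have habs : HasDerivAt (fun z => √(r z)) (deriv r p.1 / (2 * √(r p.1))) p.1 :=
        (hrd p.1).sqrt (pow_ne_zero 2 h0)
      rcases lt_or_gt_of_ne h0 with h | h
      · have hev : q =ᶠ[𝓝 p.1] fun z => -√(r z) := by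
          filter_upwards [hq.continuousAt.eventually_lt continuousAt_const h] with z hz
          simp only [hr]
          rw [Real.sqrt_sq_eq_abs, abs_of_neg hz, neg_neg]
        refine (habs.neg.congr_of_eventuallyEq hev).congr_deriv ?_
        simp only [hr]
        rw [Real.sqrt_sq_eq_abs, abs_of_neg h]
        field_simp
      · have hev : q =ᶠ[𝓝 p.1] fun z => √(r z) := by
          filter_upwards [continuousAt_const.eventually_lt hq.continuousAt h] with z hz
          simp only [hr]
          rw [Real.sqrt_sq_eq_abs, abs_of_pos hz]
        refine (habs.congr_of_eventuallyEq hev).congr_deriv ?_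
        simp only [hr]
        rw [Real.sqrt_sq_eq_abs, abs_of_pos h]
    have hU1 : HasFDerivAt U (fderiv ℝ U (q p.1, p.2)) (q p.1, p.2) :=
      ((hU p.1 p.2).differentiableAt one_ne_zero).hasFDerivAt
    have hcomp := hU1.comp p ((hqd.hasFDerivAt_comp_fst).prodMk (hasFDerivAt_snd (𝕜 := ℝ) (p := p)))
    refine (hr1.mul hcomp).congr_fderiv ?_
    rw [planeForm_eta (fderiv ℝ U (q p.1, p.2))]
    refine ContinuousLinearMap.ext fun w => ?_
    simp [hr]
    field_simp
    ring

/-- The partial derivative in the second variable of a smooth function of two variables. -/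
lemma contDiffAt_fderiv_snd {U : ℝ × ℝ → ℝ} {a : ℝ × ℝ} (hU : ContDiffAt ℝ ∞ U a) :
    ContDiffAt ℝ ∞ (fun p => fderiv ℝ U p (0, 1)) a :=
  (hU.fderiv_right (m := ∞) (by simp)).clm_apply contDiffAt_const

lemma hasDerivAt_snd_of_contDiffAt {U : ℝ × ℝ → ℝ} {s y : ℝ} (hU : ContDiffAt ℝ ∞ U (s, y)) :
    HasDerivAt (fun y => U (s, y)) (fderiv ℝ U (s, y) (0, 1)) y := by
  have h := (hU.differentiableAt (by simp)).hasFDerivAt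
  exact h.comp_hasDerivAt y ((hasDerivAt_const y s).prodMk (hasDerivAt_id y))

/-- Parametric primitives of `q ^ 2 U(q, y)` are of class `C¹`. -/
lemma contDiff_primitive_sq_mul_comp {q : ℝ → ℝ} (hq : Continuous q)
    (hq2 : ContDiff ℝ 1 fun z => q z ^ 2) {U : ℝ × ℝ → ℝ}
    (hU : ∀ z y, ContDiffAt ℝ ∞ U (q z, y)) :
    (∀ p, HasFDerivAt (fun p : ℝ × ℝ => ∫ t in (0:ℝ)..p.1, q t ^ 2 * U (q t, p.2))
      (planeForm (q p.1 ^ 2 * U (q p.1, p.2))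
        (∫ t in (0:ℝ)..p.1, q t ^ 2 * fderiv ℝ U (q t, p.2) (0, 1))) p) ∧
    ContDiff ℝ 1 (fun p : ℝ × ℝ => ∫ t in (0:ℝ)..p.1, q t ^ 2 * U (q t, p.2)) := by
  have h1 : ContDiff ℝ 1 (fun p : ℝ × ℝ => q p.1 ^ 2 * U (q p.1, p.2)) :=
    contDiff_sq_mul_comp hq hq2 fun z y => (hU z y).of_le (by simp)
  have h2 : ContDiff ℝ 1 (fun p : ℝ × ℝ => q p.1 ^ 2 * fderiv ℝ U (q p.1, p.2) (0, 1)) :=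
    contDiff_sq_mul_comp hq hq2 (U := fun p => fderiv ℝ U p (0, 1))
      fun z y => (contDiffAt_fderiv_snd (hU z y)).of_le (by simp)
  have hd := hasFDerivAt_parametric_primitive h1.continuous h2.continuous
    (fun z y => (hasDerivAt_snd_of_contDiffAt (hU z y)).const_mul (q z ^ 2))
  exact ⟨hd, contDiff_one_of_planeForm h1.continuous
    (continuous_parametric_primitive h2.continuous) hd⟩

/-! ### The isotopy and its velocity field -/

/-- A smooth function equal to `0` for `y ≤ 1/3` and to `1` for `y ≥ 2/3`. -/
noncomputable def cutoff (y : ℝ) : ℝ := Real.smoothTransition (3 * y - 1)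

lemma contDiff_cutoff : ContDiff ℝ ∞ cutoff :=
  Real.smoothTransition.contDiff.comp (by fun_prop)

lemma cutoff_nonneg (y : ℝ) : 0 ≤ cutoff y := Real.smoothTransition.nonneg _

lemma cutoff_le_one (y : ℝ) : cutoff y ≤ 1 := Real.smoothTransition.le_one _

lemma cutoff_eq_zero {y : ℝ} (hy : y ≤ 1 / 3) : cutoff y = 0 :=
  Real.smoothTransition.zero_of_nonpos (by linarith)

lemma cutoff_eq_one {y : ℝ} (hy : 2 / 3 ≤ y) : cutoff y = 1 :=
  Real.smoothTransition.one_of_one_le (by linarith)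

lemma contDiff_deriv_cutoff : ContDiff ℝ ∞ (deriv cutoff) :=
  (contDiff_infty_iff_deriv.1 contDiff_cutoff).2

lemma hasDerivAt_cutoff (y : ℝ) : HasDerivAt cutoff (deriv cutoff y) y :=
  (contDiff_cutoff.differentiable (by simp) y).hasDerivAt

lemma hasDerivAt_deriv_cutoff (y : ℝ) :
    HasDerivAt (deriv cutoff) (deriv (deriv cutoff) y) y :=
  (contDiff_deriv_cutoff.differentiable (by simp) y).hasDerivAt

lemma deriv_cutoff_eq_zero {y : ℝ} (hy : y ∉ Ioo (1 / 3 : ℝ) (2 / 3)) : deriv cutoff y = 0 := by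
  rw [mem_Ioo, not_and_or, not_lt, not_lt] at hy
  rcases hy with hy | hy
  · refine IsLocalMin.deriv_eq_zero (Eventually.of_forall fun z => ?_)
    rw [cutoff_eq_zero hy]; exact cutoff_nonneg z
  · refine IsLocalMax.deriv_eq_zero (Eventually.of_forall fun z => ?_)
    rw [cutoff_eq_one hy]; exact cutoff_le_one z

lemma hasCompactSupport_deriv_cutoff : HasCompactSupport (deriv cutoff) :=
  HasCompactSupport.of_support_subset_isCompact (isCompact_Icc (a := (1 / 3 : ℝ)) (b := 2 / 3))
    fun y hy => by
      by_contra h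
      exact hy (deriv_cutoff_eq_zero fun h' => h (Ioo_subset_Icc_self h'))

namespace IsDisplacement

variable {ψ q : ℝ → ℝ} {ε : ℝ} (hd : IsDisplacement ψ q ε)

/-- The isotopy from the identity to `x ↦ x + ψ x`. -/
noncomputable def isotopy (ψ : ℝ → ℝ) (p : ℝ × ℝ) : ℝ := p.1 + cutoff p.2 * ψ p.1

/-- The inverse of the isotopy in its first variable. -/
noncomputable def label (ψ : ℝ → ℝ) (p : ℝ × ℝ) : ℝ :=
  Function.invFun (fun z => isotopy ψ (z, p.2)) p.1

include hd

lemma le_jacobian (z y : ℝ) : ε ≤ 1 + cutoff y * q z := by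
  nlinarith [hd.le z, cutoff_nonneg y, cutoff_le_one y, hd.eps_le,
    mul_le_mul_of_nonneg_left (hd.le z) (cutoff_nonneg y)]

lemma jacobian_pos (z y : ℝ) : 0 < 1 + cutoff y * q z := hd.eps_pos.trans_le (hd.le_jacobian z y)

lemma continuous_psi : Continuous ψ :=
  continuous_iff_continuousAt.2 fun x => (hd.hasDerivAt x).continuousAt

lemma contDiff_psi : ContDiff ℝ 1 ψ := by
  rw [contDiff_one_iff_deriv]
  refine ⟨fun x => (hd.hasDerivAt x).differentiableAt, ?_⟩
  rw [funext fun x => (hd.hasDerivAt x).deriv]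
  exact hd.continuous

lemma exists_bound_psi : ∃ M, ∀ x, |ψ x| ≤ M := by
  obtain ⟨M, hM⟩ := isCompact_Icc.exists_bound_of_continuousOn (s := Icc (0:ℝ) 1)
    hd.continuous_psi.continuousOn
  refine ⟨M, fun x => ?_⟩
  have hp : Function.Periodic ψ 1 := hd.periodic
  rw [← hp.sub_int_mul_eq ⌊x⌋, mul_one]
  exact hM _ ⟨Int.fract_nonneg x, (Int.fract_lt_one x).le⟩

lemma exists_bound_q : ∃ M, ∀ x, |q x| ≤ M := by
  obtain ⟨M, hM⟩ := isCompact_Icc.exists_bound_of_continuousOn (s := Icc (0:ℝ) 1)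
    hd.continuous.continuousOn
  have hp : Function.Periodic q 1 := fun x => by
    have h1 := (hd.hasDerivAt (x + 1)).comp_add_const x 1
    rw [funext hd.periodic] at h1
    exact h1.unique (hd.hasDerivAt x)
  refine ⟨M, fun x => ?_⟩
  rw [← hp.sub_int_mul_eq ⌊x⌋, mul_one]
  exact hM _ ⟨Int.fract_nonneg x, (Int.fract_lt_one x).le⟩

lemma hasDerivAt_isotopy_fst (z y : ℝ) :
    HasDerivAt (fun z => isotopy ψ (z, y)) (1 + cutoff y * q z) z :=
  (hasDerivAt_id' z).fun_add ((hd.hasDerivAt z).const_mul (cutoff y))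

lemma hasFDerivAt_isotopy (p : ℝ × ℝ) :
    HasFDerivAt (isotopy ψ)
      (planeForm (1 + cutoff p.2 * q p.1) (deriv cutoff p.2 * ψ p.1)) p := by
  refine ((hasFDerivAt_fst (𝕜 := ℝ) (p := p)).fun_add
    ((hasDerivAt_cutoff p.2).hasFDerivAt_comp_snd.mul
      (hd.hasDerivAt p.1).hasFDerivAt_comp_fst)).congr_fderiv ?_
  refine ContinuousLinearMap.ext fun w => ?_
  simp
  ring

lemma isotopy_expanding {z z' : ℝ} (h : z ≤ z') (y : ℝ) :
    ε * (z' - z) ≤ isotopy ψ (z', y) - isotopy ψ (z, y) := by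
  have hm : Monotone (fun z => isotopy ψ (z, y) - ε * z) :=
    monotone_of_hasDerivAt_nonneg (f' := fun z => 1 + cutoff y * q z - ε)
      (fun z => by
        simpa using (hd.hasDerivAt_isotopy_fst z y).fun_sub ((hasDerivAt_id' z).const_mul ε))
      (fun z => sub_nonneg.2 (hd.le_jacobian z y))
  have := hm h
  simp only at this
  linarith

lemma abs_isotopy_sub (z z' y : ℝ) :
    ε * |z - z'| ≤ |isotopy ψ (z, y) - isotopy ψ (z', y)| := by
  rcases le_total z z' with h | h
  · have := hd.isotopy_expanding h y
    rw [abs_sub_comm z, abs_sub_comm (isotopy ψ _), abs_of_nonneg (sub_nonneg.2 h)]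
    exact this.trans (le_abs_self _)
  · have := hd.isotopy_expanding h y
    rw [abs_of_nonneg (sub_nonneg.2 h)]
    exact this.trans (le_abs_self _)

lemma isotopy_strictMono (y : ℝ) : StrictMono (fun z => isotopy ψ (z, y)) := fun z z' h => by
  have := hd.isotopy_expanding h.le y
  have := mul_pos hd.eps_pos (sub_pos.2 h)
  simp only; linarith

lemma isotopy_surjective (y : ℝ) : Function.Surjective (fun z => isotopy ψ (z, y)) := by
  refine Continuous.surjective ?_ ?_ ?_
  · exact continuous_iff_continuousAt.2 fun z => (hd.hasDerivAt_isotopy_fst z y).continuousAt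
  · refine tendsto_atTop_mono' _ (f₁ := fun z => isotopy ψ (0, y) + ε * z) ?_
      (tendsto_atTop_add_const_left _ _ (tendsto_id.const_mul_atTop hd.eps_pos))
    filter_upwards [eventually_ge_atTop 0] with z hz
    have := hd.isotopy_expanding hz y
    linarith
  · refine tendsto_atBot_mono' _ (f₁ := fun z => isotopy ψ (0, y) + ε * z) ?_
      (tendsto_atBot_add_const_left _ _ (tendsto_id.const_mul_atBot hd.eps_pos))
    filter_upwards [eventually_le_atBot 0] with z hz
    have := hd.isotopy_expanding hz y
    linarith

lemma isotopy_label (p : ℝ × ℝ) : isotopy ψ (label ψ p, p.2) = p.1 :=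
  Function.rightInverse_invFun (hd.isotopy_surjective p.2) p.1

lemma label_isotopy (z y : ℝ) : label ψ (isotopy ψ (z, y), y) = z :=
  Function.leftInverse_invFun (hd.isotopy_strictMono y).injective z

lemma label_eq_iff {p : ℝ × ℝ} {z : ℝ} : label ψ p = z ↔ isotopy ψ (z, p.2) = p.1 := by
  constructor
  · rintro rfl; exact hd.isotopy_label p
  · intro h
    have := hd.label_isotopy z p.2
    rwa [h] at this

lemma label_add_int (x y : ℝ) (m : ℤ) : label ψ (x + m, y) = label ψ (x, y) + m := by
  rw [hd.label_eq_iff]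
  have hp : Function.Periodic ψ 1 := hd.periodic
  have h1 : ψ (label ψ (x, y) + m) = ψ (label ψ (x, y)) := by
    simpa using hp.int_mul m (label ψ (x, y))
  have h2 := hd.isotopy_label (x, y)
  simp only [isotopy] at h2 ⊢
  rw [h1]; linarith

lemma label_of_le {p : ℝ × ℝ} (hp : p.2 ≤ 1 / 3) : label ψ p = p.1 := by
  rw [hd.label_eq_iff, isotopy, cutoff_eq_zero hp, zero_mul, add_zero]

lemma label_of_ge {p : ℝ × ℝ} {z : ℝ} (hp : 2 / 3 ≤ p.2) : label ψ p = z ↔ z + ψ z = p.1 := by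
  rw [hd.label_eq_iff, isotopy, cutoff_eq_one hp, one_mul]

/-- The isotopy expands in `z` by at least `ε`, so its inverse varies at most `1 / ε` times as much
as `x` and the term `cutoff y * ψ z` at fixed `z` do together. -/
lemma exists_lipschitz_label : ∃ L, 0 ≤ L ∧ ∀ p p', |label ψ p - label ψ p'| ≤ L * ‖p - p'‖ := by
  obtain ⟨M, hM⟩ := hd.exists_bound_psi
  have hM0 : 0 ≤ M := (abs_nonneg _).trans (hM 0)
  obtain ⟨K, hK⟩ := contDiff_deriv_cutoff.continuous.bounded_above_of_compact_support
    hasCompactSupport_deriv_cutoff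
  have hK0 : 0 ≤ K := (norm_nonneg _).trans (hK 0)
  have hcut : ∀ y y', |cutoff y - cutoff y'| ≤ K * |y - y'| := fun y y' => by
    have := Convex.norm_image_sub_le_of_norm_deriv_le (s := univ) (f := cutoff) (C := K)
      (fun x _ => (hasDerivAt_cutoff x).differentiableAt) (fun x _ => hK x) convex_univ
      (mem_univ y') (mem_univ y)
    simpa using this
  have hε := hd.eps_pos
  refine ⟨(1 + K * M) / ε, by positivity, fun p p' => ?_⟩
  have h1 := hd.abs_isotopy_sub (label ψ p) (label ψ p') p.2
  have h2 : isotopy ψ (label ψ p, p.2) - isotopy ψ (label ψ p', p.2)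
      = (p.1 - p'.1) - (cutoff p.2 - cutoff p'.2) * ψ (label ψ p') := by
    rw [hd.isotopy_label p]
    have h3 := hd.isotopy_label p'
    simp only [isotopy] at h3 ⊢
    linarith
  rw [h2] at h1
  have h3 : |(p.1 - p'.1) - (cutoff p.2 - cutoff p'.2) * ψ (label ψ p')|
      ≤ ‖p - p'‖ + K * ‖p - p'‖ * M := by
    refine (abs_sub _ _).trans (add_le_add (norm_fst_le (p - p')) ?_)
    rw [abs_mul]
    refine mul_le_mul ((hcut _ _).trans ?_) (hM _) (abs_nonneg _) (by positivity)
    exact mul_le_mul_of_nonneg_left (norm_snd_le (p - p')) hK0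
  rw [div_mul_eq_mul_div, le_div_iff₀ hε]
  linarith

lemma continuous_label : Continuous (label ψ) := by
  obtain ⟨L, hL0, hL⟩ := hd.exists_lipschitz_label
  refine (LipschitzWith.of_dist_le_mul (K := L.toNNReal) fun p p' => ?_).continuous
  rw [Real.coe_toNNReal _ hL0, Real.dist_eq, dist_eq_norm]
  exact hL p p'

/-- Implicit differentiation of `isotopy ψ (label ψ p, p.2) = p.1`: since `label` is Lipschitz, the
first order remainder of the isotopy is `o(w - p)`, and one divides by the positive Jacobian. -/
lemma hasFDerivAt_label (p : ℝ × ℝ) :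
    HasFDerivAt (label ψ) (planeForm (1 / (1 + cutoff p.2 * q (label ψ p)))
      (-(deriv cutoff p.2 * ψ (label ψ p)) / (1 + cutoff p.2 * q (label ψ p)))) p := by
  obtain ⟨L, hL0, hL⟩ := hd.exists_lipschitz_label
  have hJ := hd.jacobian_pos (label ψ p) p.2
  have h1 := (hasFDerivAt_iff_isLittleO.1 (hd.hasFDerivAt_isotopy (label ψ p, p.2)))
  have hc : Tendsto (fun p => (label ψ p, p.2)) (𝓝 p) (𝓝 (label ψ p, p.2)) :=
    (hd.continuous_label.prodMk continuous_snd).tendsto p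
  have h2 := h1.comp_tendsto hc
  have h3 : ((fun w : ℝ × ℝ => w - (label ψ p, p.2)) ∘ fun p => (label ψ p, p.2))
      =O[𝓝 p] fun w => w - p := by
    refine Asymptotics.IsBigO.of_bound (max L 1) (Eventually.of_forall fun w => ?_)
    simp only [Function.comp, Prod.mk_sub_mk, Prod.norm_mk]
    refine max_le ((hL w p).trans ?_) ((norm_snd_le (w - p)).trans ?_)
    · gcongr; exact le_max_left _ _
    · exact le_mul_of_one_le_left (norm_nonneg _) (le_max_right _ _)
  have h4 := (h2.trans_isBigO h3).const_mul_left (-(1 / (1 + cutoff p.2 * q (label ψ p))))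
  rw [hasFDerivAt_iff_isLittleO]
  refine h4.congr_left fun w => ?_
  simp only [Function.comp, hd.isotopy_label, planeForm_apply, Prod.fst_sub, Prod.snd_sub]
  field_simp
  ring

lemma contDiff_label : ContDiff ℝ 1 (label ψ) := by
  have hc := hd.continuous_label
  have hJ : ∀ p : ℝ × ℝ, 1 + cutoff p.2 * q (label ψ p) ≠ 0 := fun p => (hd.jacobian_pos _ _).ne'
  have h1 := contDiff_cutoff.continuous
  have h2 := contDiff_deriv_cutoff.continuous
  have h3 := hd.continuous
  have h4 := hd.continuous_psi
  refine contDiff_one_of_planeForm ?_ ?_ hd.hasFDerivAt_label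
  · exact continuous_const.div (by fun_prop) hJ
  · exact Continuous.div (by fun_prop) (by fun_prop) hJ

/-- The horizontal component of the vector field generating the isotopy. -/
noncomputable def field (ψ : ℝ → ℝ) (p : ℝ × ℝ) : ℝ := deriv cutoff p.2 * ψ (label ψ p)

/-- The first partial derivative of `field`. -/
noncomputable def fieldX (ψ q : ℝ → ℝ) (p : ℝ × ℝ) : ℝ :=
  deriv cutoff p.2 * q (label ψ p) * (1 + cutoff p.2 * q (label ψ p))⁻¹

/-- The second partial derivative of `field`. -/
noncomputable def fieldY (ψ q : ℝ → ℝ) (p : ℝ × ℝ) : ℝ :=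
  deriv (deriv cutoff) p.2 * ψ (label ψ p) - deriv cutoff p.2 * ψ (label ψ p) * fieldX ψ q p

lemma hasFDerivAt_field (p : ℝ × ℝ) :
    HasFDerivAt (field ψ) (planeForm (fieldX ψ q p) (fieldY ψ q p)) p := by
  have hJ := (hd.jacobian_pos (label ψ p) p.2).ne'
  refine ((hasDerivAt_deriv_cutoff p.2).hasFDerivAt_comp_snd.mul
    ((hd.hasDerivAt (label ψ p)).comp_hasFDerivAt p (hd.hasFDerivAt_label p))).congr_fderiv ?_
  refine ContinuousLinearMap.ext fun w => ?_
  simp [fieldX, fieldY]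
  field_simp
  ring

lemma continuous_fieldX : Continuous (fieldX ψ q) := by
  have hc := hd.continuous_label
  have hJ : ∀ p : ℝ × ℝ, 1 + cutoff p.2 * q (label ψ p) ≠ 0 := fun p => (hd.jacobian_pos _ _).ne'
  have h1 := contDiff_cutoff.continuous
  have h2 := contDiff_deriv_cutoff.continuous
  have h3 := hd.continuous
  unfold fieldX
  exact Continuous.mul (by fun_prop) (Continuous.inv₀ (by fun_prop) hJ)

lemma continuous_fieldY : Continuous (fieldY ψ q) := by
  have hc := hd.continuous_label
  have h1 := hd.continuous_fieldX
  have h2 := contDiff_deriv_cutoff.continuous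
  have h3 : Continuous (deriv (deriv cutoff)) :=
    contDiff_deriv_cutoff.continuous_deriv (by simp)
  have h4 := hd.continuous_psi
  unfold fieldY
  fun_prop

lemma contDiff_field : ContDiff ℝ 1 (field ψ) :=
  contDiff_one_of_planeForm hd.continuous_fieldX hd.continuous_fieldY hd.hasFDerivAt_field

/-- The integral of the square of the first partial derivative of `field` is `C²`. -/
theorem contDiff_integral_fieldX_sq :
    ContDiff ℝ 2 (fun p : ℝ × ℝ => ∫ ξ in (0:ℝ)..p.1, fieldX ψ q (ξ, p.2) ^ 2) := by
  -- Under `ξ = isotopy ψ (z, y)` the Jacobian cancels one of the two factors `(1 + cutoff y * q)⁻¹`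
  -- in `fieldX ^ 2`, leaving `q ^ 2 U(q, y)`.
  set U : ℝ × ℝ → ℝ := fun a => deriv cutoff a.2 ^ 2 * (1 + cutoff a.2 * a.1)⁻¹ with hU
  have hcut : ContDiff ℝ ∞ (fun a : ℝ × ℝ => cutoff a.2) := contDiff_cutoff.comp contDiff_snd
  have hcut' : ContDiff ℝ ∞ (fun a : ℝ × ℝ => deriv cutoff a.2) :=
    contDiff_deriv_cutoff.comp contDiff_snd
  have hinv : ∀ z y, ContDiffAt ℝ ∞ (fun a : ℝ × ℝ => (1 + cutoff a.2 * a.1)⁻¹) (q z, y) :=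
    fun z y => (contDiffAt_const.add (hcut.contDiffAt.mul contDiffAt_fst)).inv
      (hd.jacobian_pos z y).ne'
  have hUs : ∀ z y, ContDiffAt ℝ ∞ U (q z, y) := fun z y =>
    (hcut'.contDiffAt.pow 2).mul (hinv z y)
  obtain ⟨hB, hB1⟩ := contDiff_primitive_sq_mul_comp hd.continuous hd.contDiff_sq hUs
  obtain ⟨-, hB2⟩ := contDiff_primitive_sq_mul_comp hd.continuous hd.contDiff_sq
    (fun z y => contDiffAt_fderiv_snd (hUs z y))
  set B : ℝ × ℝ → ℝ := fun p => ∫ t in (0:ℝ)..p.1, q t ^ 2 * U (q t, p.2) with hBdef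
  set B' : ℝ × ℝ → ℝ := fun p => ∫ t in (0:ℝ)..p.1, q t ^ 2 * fderiv ℝ U (q t, p.2) (0, 1) with hB'
  set V : ℝ × ℝ → ℝ := fun a => deriv cutoff a.2 ^ 3 * ((1 + cutoff a.2 * a.1)⁻¹) ^ 2 with hV
  have hVs := contDiff_sq_mul_comp hd.continuous hd.contDiff_sq (U := V) fun z y =>
    (((hcut'.contDiffAt.pow 3).mul ((hinv z y).pow 2)).of_le (by simp))
  -- This is the `y`-derivative of `T` below, written in terms of the label: `B'` comes from the
  -- parameter, and the term with `V` from moving the upper limit with the `y`-derivative of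
  -- `label`.
  set N : ℝ × ℝ → ℝ := fun p => B' p - ψ p.1 * (q p.1 ^ 2 * V (q p.1, p.2)) with hN
  have hN1 : ContDiff ℝ 1 N := hB2.sub ((hd.contDiff_psi.comp contDiff_fst).mul hVs)
  set T : ℝ × ℝ → ℝ := fun p => B (label ψ p, p.2) with hT
  have hlab : ContDiff ℝ 1 (fun p : ℝ × ℝ => (label ψ p, p.2)) :=
    hd.contDiff_label.prodMk contDiff_snd
  have hTd : ∀ p, HasFDerivAt T (planeForm (fieldX ψ q p ^ 2) (N (label ψ p, p.2))) p := by
    intro p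
    have hJ := (hd.jacobian_pos (label ψ p) p.2).ne'
    refine ((hB (label ψ p, p.2)).comp p
      ((hd.hasFDerivAt_label p).prodMk (hasFDerivAt_snd (𝕜 := ℝ) (p := p)))).congr_fderiv ?_
    refine ContinuousLinearMap.ext fun w => ?_
    simp only [ContinuousLinearMap.comp_apply, ContinuousLinearMap.prod_apply, planeForm_apply,
      ContinuousLinearMap.coe_snd', hN, hU, hV, fieldX]
    rw [show (∫ t in (0:ℝ)..label ψ p, q t ^ 2 * fderiv ℝ (fun a : ℝ × ℝ =>
      deriv cutoff a.2 ^ 2 * (1 + cutoff a.2 * a.1)⁻¹) (q t, p.2) (0, 1)) = B' (label ψ p, p.2)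
      from rfl]
    field_simp
    ring
  have hint : ∀ p : ℝ × ℝ, ∫ ξ in (0:ℝ)..p.1, fieldX ψ q (ξ, p.2) ^ 2 = T p - T (0, p.2) := by
    intro p
    refine intervalIntegral.integral_eq_sub_of_hasDerivAt (f := fun ξ => T (ξ, p.2))
      (fun ξ _ => ?_) (Continuous.intervalIntegrable ?_ _ _)
    · have := (hTd (ξ, p.2)).comp_hasDerivAt ξ ((hasDerivAt_id ξ).prodMk (hasDerivAt_const ξ p.2))
      simpa [Function.comp_def] using this
    · have := hd.continuous_fieldX
      fun_prop
  simp only [hint]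
  have hX : ContDiff ℝ 1 (fun p => fieldX ψ q p ^ 2) := by
    have h1 := contDiff_sq_mul_comp hd.continuous hd.contDiff_sq
      (U := fun a => (deriv cutoff a.2 * (1 + cutoff a.2 * a.1)⁻¹) ^ 2) fun z y =>
      (((hcut'.contDiffAt.mul (hinv z y)).pow 2).of_le (by simp))
    convert h1.comp hlab using 2 with p
    simp only [fieldX, Function.comp]; ring
  refine contDiff_two_of_planeForm hX
    (v := fun p => N (label ψ p, p.2) - N (label ψ (0, p.2), p.2)) ?_ fun p => ?_
  · refine (hN1.comp hlab).sub (hN1.comp (hlab.comp (g := fun p : ℝ × ℝ => (label ψ p, p.2))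
      (f := fun p : ℝ × ℝ => ((0:ℝ), p.2)) (contDiff_const.prodMk contDiff_snd)))
  · have h0 : HasDerivAt (fun y => T (0, y)) (N (label ψ (0, p.2), p.2)) p.2 := by
      have := (hTd (0, p.2)).comp_hasDerivAt p.2
        ((hasDerivAt_const p.2 (0:ℝ)).prodMk (hasDerivAt_id p.2))
      simpa [Function.comp_def] using this
    refine ((hTd p).fun_sub h0.hasFDerivAt_comp_snd).congr_fderiv ?_
    refine ContinuousLinearMap.ext fun w => ?_
    simp
    ring

end IsDisplacement

/-! ### Hölder functions on the plane and periodization -/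

/-- Bounded Hölder functions on the plane. -/
def IsBddHolder (α : ℝ) (f : ℝ × ℝ → ℝ) : Prop :=
  ∃ M C : ℝ, (∀ p, |f p| ≤ M) ∧ ∀ p p', |f p - f p'| ≤ C * ‖p - p'‖ ^ α

namespace IsBddHolder

variable {α : ℝ} {f g : ℝ × ℝ → ℝ}

lemma mul (hf : IsBddHolder α f) (hg : IsBddHolder α g) : IsBddHolder α (fun p => f p * g p) := by
  obtain ⟨M, C, hM, hC⟩ := hf
  obtain ⟨M', C', hM', hC'⟩ := hg
  refine ⟨M * M', M * C' + M' * C, fun p => ?_, fun p p' => ?_⟩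
  · rw [abs_mul]
    exact mul_le_mul (hM p) (hM' p) (abs_nonneg _) ((abs_nonneg _).trans (hM p))
  · rw [show f p * g p - f p' * g p' = f p * (g p - g p') + g p' * (f p - f p') by ring]
    refine (abs_add_le _ _).trans ?_
    rw [abs_mul, abs_mul, add_mul, mul_assoc, mul_assoc]
    exact add_le_add
      (mul_le_mul (hM p) (hC' p p') (abs_nonneg _) ((abs_nonneg _).trans (hM p)))
      (mul_le_mul (hM' p') (hC p p') (abs_nonneg _) ((abs_nonneg _).trans (hM' p)))

lemma sub (hf : IsBddHolder α f) (hg : IsBddHolder α g) : IsBddHolder α (fun p => f p - g p) := by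
  obtain ⟨M, C, hM, hC⟩ := hf
  obtain ⟨M', C', hM', hC'⟩ := hg
  refine ⟨M + M', C + C', fun p => (abs_sub _ _).trans (add_le_add (hM p) (hM' p)),
    fun p p' => ?_⟩
  rw [show f p - g p - (f p' - g p') = f p - f p' - (g p - g p') by ring, add_mul]
  exact (abs_sub _ _).trans (add_le_add (hC p p') (hC' p p'))

lemma inv_one_add (hf : IsBddHolder α f) {ε : ℝ} (hε : 0 < ε) (h : ∀ p, ε ≤ 1 + f p) :
    IsBddHolder α (fun p => (1 + f p)⁻¹) := by
  obtain ⟨M, C, hM, hC⟩ := hf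
  refine ⟨ε⁻¹, (ε ^ 2)⁻¹ * C, fun p => ?_, fun p p' => ?_⟩
  · rw [abs_of_pos (inv_pos.2 (hε.trans_le (h p)))]
    exact inv_anti₀ hε (h p)
  · have h1 := hε.trans_le (h p)
    have h2 := hε.trans_le (h p')
    rw [inv_sub_inv h1.ne' h2.ne', abs_div, abs_of_pos (mul_pos h1 h2), div_eq_inv_mul,
      mul_assoc]
    refine mul_le_mul (inv_anti₀ (by positivity) ?_) ?_ (abs_nonneg _) (by positivity)
    · rw [sq]; exact mul_le_mul (h p) (h p') hε.le h1.le
    · rw [show 1 + f p' - (1 + f p) = -(f p - f p') by ring, abs_neg]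
      exact hC p p'

lemma of_lipschitz {M L : ℝ} (hα0 : 0 ≤ α) (hα1 : α ≤ 1) (hM : ∀ p, |f p| ≤ M)
    (hL : ∀ p p', |f p - f p'| ≤ L * ‖p - p'‖) : IsBddHolder α f := by
  refine ⟨M, max (2 * M) L, hM, fun p p' => ?_⟩
  rcases le_total ‖p - p'‖ 1 with h | h
  · have h1 := Real.self_le_rpow_of_le_one (norm_nonneg (p - p')) h hα1
    have hmax : 0 ≤ max (2 * M) L := le_max_of_le_left (by linarith [abs_nonneg (f p), hM p])
    calc |f p - f p'| ≤ L * ‖p - p'‖ := hL p p'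
      _ ≤ max (2 * M) L * ‖p - p'‖ := by gcongr; exact le_max_right _ _
      _ ≤ _ := by gcongr
  · have h1 := Real.one_le_rpow h hα0
    have h2 : |f p - f p'| ≤ 2 * M := by
      linarith [abs_sub (f p) (f p'), hM p, hM p']
    have hmax : 0 ≤ max (2 * M) L := le_max_of_le_left (by linarith [abs_nonneg (f p), hM p])
    nlinarith [le_max_left (2 * M) L]

lemma comp_snd {g : ℝ → ℝ} (hα0 : 0 ≤ α) (hα1 : α ≤ 1) (hg : ContDiff ℝ ∞ g) {M : ℝ}
    (hM : ∀ y, |g y| ≤ M) (hs : HasCompactSupport (deriv g)) :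
    IsBddHolder α (fun p => g p.2) := by
  obtain ⟨K, hK⟩ := (hg.continuous_deriv (by simp)).bounded_above_of_compact_support hs
  refine of_lipschitz (M := M) (L := K) hα0 hα1 (fun p => hM p.2) fun p p' => ?_
  have := Convex.norm_image_sub_le_of_norm_deriv_le (s := univ) (f := g) (C := K)
    (fun x _ => hg.differentiable (by simp) x) (fun x _ => hK x) convex_univ
    (mem_univ p'.2) (mem_univ p.2)
  exact this.trans (mul_le_mul_of_nonneg_left (norm_snd_le (p - p'))
    ((norm_nonneg _).trans (hK 0)))

lemma comp_snd_of_compactSupport {g : ℝ → ℝ} (hα0 : 0 ≤ α) (hα1 : α ≤ 1) (hg : ContDiff ℝ ∞ g)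
    (hs : HasCompactSupport g) : IsBddHolder α (fun p => g p.2) := by
  obtain ⟨M, hM⟩ := hg.continuous.bounded_above_of_compact_support hs
  exact comp_snd hα0 hα1 hg hM hs.deriv

end IsBddHolder

/-- The function on the plane which is `1`-periodic in `y` and agrees with `G` on `0 ≤ y < 1`. -/
noncomputable def periodizeSnd (G : ℝ × ℝ → ℝ) (p : ℝ × ℝ) : ℝ := G (p.1, Int.fract p.2)

/-- `G` vanishes outside of the strip `1/3 ≤ y ≤ 2/3`. -/
def VanishesOffStrip (G : ℝ × ℝ → ℝ) : Prop := ∀ x y, y ∉ Icc (1 / 3 : ℝ) (2 / 3) → G (x, y) = 0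

/-- The windows of consecutive integers overlap. In the two outer pieces the fractional part lies in
`(2/3, 1)` or `[0, 1/3)`, where the cutoff is constant. -/
lemma fract_cases_of_mem_window {y : ℝ} {j : ℤ} (hy : y ∈ Ioo ((j : ℝ) - 1 / 3) (j + 4 / 3)) :
    (Int.fract y = y - j ∧ y - j ∈ Ico (0:ℝ) 1) ∨ (Int.fract y = y - j + 1 ∧ y - j < 0) ∨
      (Int.fract y = y - j - 1 ∧ 1 ≤ y - j) := by
  have h1 := hy.1
  have h2 := hy.2
  rcases lt_or_ge (y - j) 0 with h | h
  · refine Or.inr (Or.inl ⟨?_, h⟩)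
    rw [Int.fract, show ⌊y⌋ = j - 1 from Int.floor_eq_iff.2 ⟨by push_cast; linarith,
      by push_cast; linarith⟩]
    push_cast; ring
  rcases lt_or_ge (y - j) 1 with h' | h'
  · refine Or.inl ⟨?_, h, h'⟩
    rw [Int.fract, show ⌊y⌋ = j from Int.floor_eq_iff.2 ⟨by linarith, by linarith⟩]
  · refine Or.inr (Or.inr ⟨?_, h'⟩)
    rw [Int.fract, show ⌊y⌋ = j + 1 from Int.floor_eq_iff.2 ⟨by push_cast; linarith,
      by push_cast; linarith⟩]
    push_cast; ring

namespace VanishesOffStrip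

variable {G : ℝ × ℝ → ℝ} (hG : VanishesOffStrip G)
include hG

lemma periodizeSnd_eq {p : ℝ × ℝ} {j : ℤ} (hp : p.2 ∈ Ioo ((j : ℝ) - 1 / 3) (j + 4 / 3)) :
    periodizeSnd G p = G (p.1, p.2 - j) := by
  have h1 := hp.1
  have h2 := hp.2
  unfold periodizeSnd
  rcases fract_cases_of_mem_window hp with ⟨h, -⟩ | ⟨h, h'⟩ | ⟨h, h'⟩
  · rw [h]
  · rw [h, hG _ _ fun hh => by linarith [hh.2], hG _ _ fun hh => by linarith [hh.1]]
  · rw [h, hG _ _ fun hh => by linarith [hh.1], hG _ _ fun hh => by linarith [hh.2]]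

lemma eventually_periodizeSnd_eq (p : ℝ × ℝ) :
    ∀ᶠ p' in 𝓝 p, periodizeSnd G p' = G (p'.1, p'.2 - ⌊p.2⌋) := by
  have h1 := Int.floor_le p.2
  have h2 := Int.lt_floor_add_one p.2
  filter_upwards [continuous_snd.continuousAt.preimage_mem_nhds
    (Ioo_mem_nhds (show (⌊p.2⌋ : ℝ) - 1 / 3 < p.2 by linarith)
      (show p.2 < ⌊p.2⌋ + 4 / 3 by linarith))] with p' hp'
  exact hG.periodizeSnd_eq hp'

lemma contDiff_periodizeSnd {n : WithTop ℕ∞} (h : ContDiff ℝ n G) :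
    ContDiff ℝ n (periodizeSnd G) := by
  refine contDiff_iff_contDiffAt.2 fun p => ?_
  refine ContDiffAt.congr_of_eventuallyEq (f := fun p' : ℝ × ℝ => G (p'.1, p'.2 - ⌊p.2⌋)) ?_
    (hG.eventually_periodizeSnd_eq p)
  exact (h.comp (contDiff_fst.prodMk (contDiff_snd.sub contDiff_const))).contDiffAt

lemma hasFDerivAt_periodizeSnd {u v : ℝ × ℝ → ℝ}
    (h : ∀ p, HasFDerivAt G (planeForm (u p) (v p)) p) (p : ℝ × ℝ) :
    HasFDerivAt (periodizeSnd G) (planeForm (periodizeSnd u p) (periodizeSnd v p)) p := by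
  have h1 := (h (p.1, p.2 - ⌊p.2⌋)).comp p ((hasFDerivAt_fst (𝕜 := ℝ) (p := p)).prodMk
    ((hasFDerivAt_snd (𝕜 := ℝ) (p := p)).sub_const (⌊p.2⌋ : ℝ)))
  refine (h1.congr_of_eventuallyEq (hG.eventually_periodizeSnd_eq p)).congr_fderiv ?_
  simp only [periodizeSnd, ← Int.self_sub_floor]
  ext <;> simp

/-- Points closer than 1/3 lie in a common window. For the others `(3 * ‖p - p'‖) ^ α ≥ 1`, so
boundedness is enough. -/
lemma isBddHolder_periodizeSnd {α : ℝ} (hα : 0 ≤ α) (h : IsBddHolder α G) :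
    IsBddHolder α (periodizeSnd G) := by
  obtain ⟨M, C, hM, hC⟩ := h
  have hM0 : 0 ≤ M := (abs_nonneg _).trans (hM 0)
  refine ⟨M, max C (2 * M * 3 ^ α), fun p => hM _, fun p p' => ?_⟩
  rcases lt_or_ge ‖p - p'‖ (1 / 3) with hlt | hge
  · have h1 := Int.floor_le p.2
    have h2 := Int.lt_floor_add_one p.2
    have h3 : |p.2 - p'.2| < 1 / 3 := (norm_snd_le (p - p')).trans_lt hlt
    rw [abs_lt] at h3
    rw [hG.periodizeSnd_eq (j := ⌊p.2⌋) ⟨by linarith, by linarith⟩,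
      hG.periodizeSnd_eq (j := ⌊p.2⌋) (p := p') ⟨by linarith, by linarith⟩]
    refine (hC _ _).trans ?_
    rw [show ((p.1, p.2 - ⌊p.2⌋) : ℝ × ℝ) - (p'.1, p'.2 - ⌊p.2⌋) = p - p' by
      rw [Prod.mk_sub_mk, sub_sub_sub_cancel_right]; rfl]
    gcongr
    exact le_max_left _ _
  · have h1 : 1 ≤ (3:ℝ) ^ α * ‖p - p'‖ ^ α := by
      rw [← Real.mul_rpow (by norm_num) (norm_nonneg _)]
      exact Real.one_le_rpow (by linarith) hα
    have h2 : |periodizeSnd G p - periodizeSnd G p'| ≤ 2 * M := by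
      refine (abs_sub _ _).trans ?_
      linarith [hM (p.1, Int.fract p.2), hM (p'.1, Int.fract p'.2), show
        |periodizeSnd G p| ≤ M from hM _, show |periodizeSnd G p'| ≤ M from hM _]
    calc _ ≤ 2 * M * ((3:ℝ) ^ α * ‖p - p'‖ ^ α) := h2.trans (le_mul_of_one_le_right (by positivity) h1)
      _ = 2 * M * 3 ^ α * ‖p - p'‖ ^ α := by ring
      _ ≤ _ := by gcongr; exact le_max_right _ _

end VanishesOffStrip

/-! ### The vector field on the torus and its regularity -/

namespace IsDisplacement

variable {ψ q : ℝ → ℝ} {ε : ℝ} (hd : IsDisplacement ψ q ε)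

lemma deriv_cutoff_eq_zero' {y : ℝ} (hy : y ∉ Icc (1 / 3 : ℝ) (2 / 3)) : deriv cutoff y = 0 :=
  deriv_cutoff_eq_zero fun h => hy (Ioo_subset_Icc_self h)

lemma deriv_deriv_cutoff_eq_zero {y : ℝ} (hy : y ∉ Icc (1 / 3 : ℝ) (2 / 3)) :
    deriv (deriv cutoff) y = 0 := by
  have h : deriv cutoff =ᶠ[𝓝 y] fun _ => 0 := by
    filter_upwards [isClosed_Icc.isOpen_compl.mem_nhds hy] with z hz
    exact deriv_cutoff_eq_zero' hz
  rw [h.deriv_eq, deriv_const]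

lemma vanishesOffStrip_field : VanishesOffStrip (field ψ) := fun x y hy => by
  simp [field, deriv_cutoff_eq_zero' hy]

lemma vanishesOffStrip_fieldX : VanishesOffStrip (fieldX ψ q) := fun x y hy => by
  simp [fieldX, deriv_cutoff_eq_zero' hy]

lemma vanishesOffStrip_fieldY : VanishesOffStrip (fieldY ψ q) := fun x y hy => by
  simp [fieldY, deriv_cutoff_eq_zero' hy, deriv_deriv_cutoff_eq_zero hy]

include hd

lemma isBddHolder_field {α : ℝ≥0} (hα0 : 0 < α) (hα1 : α < 1) :
    IsBddHolder α (fieldX ψ q) ∧ IsBddHolder α (fieldY ψ q) := by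
  have ha0 : (0:ℝ) ≤ α := α.coe_nonneg
  have ha1 : (α:ℝ) ≤ 1 := by exact_mod_cast hα1.le
  obtain ⟨L, hL0, hL⟩ := hd.exists_lipschitz_label
  have hc : IsBddHolder α (fun p => cutoff p.2) :=
    IsBddHolder.comp_snd ha0 ha1 contDiff_cutoff (M := 1)
      (fun y => by rw [abs_of_nonneg (cutoff_nonneg y)]; exact cutoff_le_one y)
      hasCompactSupport_deriv_cutoff
  have hc1 : IsBddHolder α (fun p => deriv cutoff p.2) :=
    IsBddHolder.comp_snd_of_compactSupport ha0 ha1 contDiff_deriv_cutoff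
      hasCompactSupport_deriv_cutoff
  have hc2 : IsBddHolder α (fun p => deriv (deriv cutoff) p.2) :=
    IsBddHolder.comp_snd_of_compactSupport ha0 ha1
      (contDiff_infty_iff_deriv.1 contDiff_deriv_cutoff).2 hasCompactSupport_deriv_cutoff.deriv
  obtain ⟨Mq, hMq⟩ := hd.exists_bound_q
  obtain ⟨Mψ, hMψ⟩ := hd.exists_bound_psi
  have hMq0 : 0 ≤ Mq := (abs_nonneg _).trans (hMq 0)
  have hψ : IsBddHolder α (fun p => ψ (label ψ p)) := by
    refine IsBddHolder.of_lipschitz (M := Mψ) (L := Mq * L) ha0 ha1 (fun p => hMψ _)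
      fun p p' => ?_
    have := Convex.norm_image_sub_le_of_norm_deriv_le (s := univ) (f := ψ) (C := Mq)
      (fun x _ => (hd.hasDerivAt x).differentiableAt)
      (fun x _ => by rw [(hd.hasDerivAt x).deriv]; exact hMq x) convex_univ
      (mem_univ (label ψ p')) (mem_univ (label ψ p))
    refine this.trans ?_
    rw [mul_assoc]
    exact mul_le_mul_of_nonneg_left (hL p p') hMq0
  have hq : IsBddHolder α (fun p => q (label ψ p)) := by
    obtain ⟨C, hC⟩ := hd.holder α hα0 hα1
    refine ⟨Mq, C * L ^ (α:ℝ), fun p => hMq _, fun p p' => ?_⟩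
    have h1 := hC.dist_le (label ψ p) (label ψ p')
    rw [Real.dist_eq, Real.dist_eq] at h1
    refine h1.trans ?_
    rw [mul_assoc, ← Real.mul_rpow hL0 (norm_nonneg _)]
    gcongr
    exact hL p p'
  have hJ := (hc.mul hq).inv_one_add hd.eps_pos fun p => hd.le_jacobian (label ψ p) p.2
  have hX : IsBddHolder α (fieldX ψ q) := (hc1.mul hq).mul hJ
  exact ⟨hX, (hc2.mul hψ).sub ((hc1.mul hψ).mul hX)⟩

omit hd in
/-- The representative in `[0, 1)` of a point of the circle. -/
noncomputable def circleRep (P : UnitAddCircle) : ℝ := AddCircle.equivIco 1 0 P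

omit hd in
lemma circleRep_coe (x : ℝ) : circleRep (x : UnitAddCircle) = Int.fract x := by
  unfold circleRep
  rw [AddCircle.coe_equivIco_mk_apply, div_one, mul_one]

omit hd in
/-- The function on the torus induced by `field`. -/
noncomputable def torusField (ψ : ℝ → ℝ) (P : Torus) : ℝ := field ψ (circleRep P.1, circleRep P.2)

/-- Reducing `x` modulo 1 is harmless, because `label` commutes with integer translations and `ψ` is
periodic; only `y` has to be periodized. -/
lemma torusLift_torusField : torusLift (torusField ψ) = periodizeSnd (field ψ) := by
  ext p
  simp only [torusLift, torusProj, torusField, circleRep_coe, periodizeSnd, field]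
  congr 1
  have h1 := hd.label_add_int (Int.fract p.1) (Int.fract p.2) ⌊p.1⌋
  rw [Int.fract_add_floor] at h1
  have hp : Function.Periodic ψ 1 := hd.periodic
  rw [h1]
  simpa using (hp.int_mul ⌊p.1⌋ (label ψ (Int.fract p.1, Int.fract p.2))).symm

lemma contDiff_torusField : ContDiff ℝ 1 (torusLift (torusField ψ)) := by
  rw [hd.torusLift_torusField]
  exact vanishesOffStrip_field.contDiff_periodizeSnd hd.contDiff_field

lemma hasFDerivAt_torusField (p : ℝ × ℝ) : HasFDerivAt (torusLift (torusField ψ))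
    (planeForm (periodizeSnd (fieldX ψ q) p) (periodizeSnd (fieldY ψ q) p)) p := by
  rw [hd.torusLift_torusField]
  exact vanishesOffStrip_field.hasFDerivAt_periodizeSnd hd.hasFDerivAt_field p

lemma isC1Holder_torusField {α : ℝ≥0} (hα0 : 0 < α) (hα1 : α < 1) :
    IsC1Holder (torusField ψ) α := by
  refine ⟨hd.contDiff_torusField, ?_⟩
  obtain ⟨hX, hY⟩ := hd.isBddHolder_field hα0 hα1
  obtain ⟨-, C, -, hC⟩ := vanishesOffStrip_fieldX.isBddHolder_periodizeSnd α.coe_nonneg hX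
  obtain ⟨-, C', -, hC'⟩ := vanishesOffStrip_fieldY.isBddHolder_periodizeSnd α.coe_nonneg hY
  have hnn : ∀ {C : ℝ} {f : ℝ × ℝ → ℝ}, (∀ p p', |f p - f p'| ≤ C * ‖p - p'‖ ^ (α:ℝ)) → 0 ≤ C :=
    fun h => by
      have := (abs_nonneg _).trans (h (1, 0) (0, 0))
      simpa [Prod.norm_def] using this
  refine ⟨_, HolderWith.of_dist_le (C := C + C') (add_nonneg (hnn hC) (hnn hC')) fun p p' => ?_⟩
  rw [dist_eq_norm, dist_eq_norm, (hd.hasFDerivAt_torusField p).fderiv,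
    (hd.hasFDerivAt_torusField p').fderiv]
  have hC1 := hC p p'
  have hC2 := hC' p p'
  refine ContinuousLinearMap.opNorm_le_bound _
    (mul_nonneg (add_nonneg (hnn hC) (hnn hC')) (by positivity)) fun w => ?_
  simp only [_root_.sub_apply, planeForm_apply]
  rw [add_sub_add_comm, ← sub_mul, ← sub_mul, add_mul C, add_mul _ _ ‖w‖]
  refine (norm_add_le _ _).trans (add_le_add ?_ ?_)
  · rw [norm_mul]
    exact mul_le_mul hC1 (norm_fst_le w) (norm_nonneg _) ((abs_nonneg _).trans hC1)
  · rw [norm_mul]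
    exact mul_le_mul hC2 (norm_snd_le w) (norm_nonneg _) ((abs_nonneg _).trans hC2)

lemma partialX_torusField (x y : ℝ) :
    partialX (torusField ψ) x y = periodizeSnd (fieldX ψ q) (x, y) := by
  have := (hd.hasFDerivAt_torusField (x, y)).comp_hasDerivAt x
    ((hasDerivAt_id x).prodMk (hasDerivAt_const x y))
  simpa [Function.comp_def, partialX] using this.deriv

lemma contDiff_integral_partialX_sq : ContDiff ℝ 2
    (fun p : ℝ × ℝ => ∫ ξ in (0:ℝ)..p.1, partialX (torusField ψ) ξ p.2 ^ 2) := by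
  simp only [hd.partialX_torusField]
  refine VanishesOffStrip.contDiff_periodizeSnd
    (G := fun p : ℝ × ℝ => ∫ ξ in (0:ℝ)..p.1, fieldX ψ q (ξ, p.2) ^ 2) (fun x y hy => ?_)
    hd.contDiff_integral_fieldX_sq
  simp [vanishesOffStrip_fieldX _ _ hy]

end IsDisplacement

/-! ### Coverings, and homeomorphisms descending to the circle -/

lemma circle_coe_eq_iff {x y : ℝ} : (x : UnitAddCircle) = y ↔ ∃ m : ℤ, y = x + m := by
  rw [QuotientAddGroup.eq, AddSubgroup.mem_zmultiples_iff]
  constructor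
  · rintro ⟨m, hm⟩; exact ⟨m, by simp at hm; linarith⟩
  · rintro ⟨m, rfl⟩; exact ⟨m, by simp⟩

lemma isOpenQuotientMap_torusProj : IsOpenQuotientMap torusProj :=
  QuotientAddGroup.isOpenQuotientMap_mk.prodMap QuotientAddGroup.isOpenQuotientMap_mk

lemma torusProj_add_int (x y : ℝ) (m n : ℤ) : torusProj (x + m, y + n) = torusProj (x, y) :=
  Prod.ext (circle_coe_eq_iff.2 ⟨-m, by push_cast; ring⟩)
    (circle_coe_eq_iff.2 ⟨-n, by push_cast; ring⟩)

lemma map_add_int_of_map_add_one {f : ℝ → ℝ} (hf : ∀ x, f (x + 1) = f x + 1) (x : ℝ) (m : ℤ) :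
    f (x + m) = f x + m := by
  have hp : Function.Periodic (fun x => f x - x) 1 := fun x => by simp only [hf]; ring
  have := hp.int_mul m x
  simp only [mul_one] at this
  linarith

/-- A homeomorphism of the line commuting with the unit translation descends to the circle. -/
lemma exists_circle_homeomorph (F : ℝ ≃ₜ ℝ) (hF : ∀ x, F (x + 1) = F x + 1) :
    ∃ Φ : UnitAddCircle ≃ₜ UnitAddCircle, ∀ x : ℝ, Φ (x : UnitAddCircle) = (F x : UnitAddCircle) := by
  have hFs : ∀ x, F.symm (x + 1) = F.symm x + 1 := fun x => by
    rw [F.symm_apply_eq, hF, F.apply_symm_apply]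
  have lift : ∀ G : ℝ ≃ₜ ℝ, (∀ x, G (x + 1) = G x + 1) →
      ∃ φ : UnitAddCircle → UnitAddCircle, Continuous φ ∧
        ∀ x : ℝ, φ (x : UnitAddCircle) = (G x : UnitAddCircle) := fun G hG => by
    have hφ : ∀ x : ℝ, ((G (IsDisplacement.circleRep (x : UnitAddCircle)) : ℝ) : UnitAddCircle)
        = (G x : UnitAddCircle) := fun x => by
      rw [IsDisplacement.circleRep_coe, circle_coe_eq_iff]
      refine ⟨⌊x⌋, ?_⟩
      rw [← map_add_int_of_map_add_one hG, Int.fract_add_floor]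
    refine ⟨fun P => (G (IsDisplacement.circleRep P) : UnitAddCircle), ?_, hφ⟩
    rw [QuotientAddGroup.isOpenQuotientMap_mk.isQuotientMap.continuous_iff]
    exact ((AddCircle.continuous_mk' 1).comp G.continuous).congr fun x => (hφ x).symm
  obtain ⟨φ, hφc, hφ⟩ := lift F hF
  obtain ⟨φ', hφc', hφ'⟩ := lift F.symm hFs
  refine ⟨⟨⟨φ, φ', fun P => ?_, fun P => ?_⟩, hφc, hφc'⟩, hφ⟩
  · obtain ⟨x, rfl⟩ := QuotientAddGroup.mk_surjective P
    rw [hφ, hφ', F.symm_apply_apply]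
  · obtain ⟨x, rfl⟩ := QuotientAddGroup.mk_surjective P
    rw [hφ', hφ, F.apply_symm_apply]

lemma circle_homeomorph_zpow {F : ℝ ≃ₜ ℝ} {Φ : UnitAddCircle ≃ₜ UnitAddCircle}
    (h : ∀ x : ℝ, Φ (x : UnitAddCircle) = (F x : UnitAddCircle)) (n : ℤ) (x : ℝ) :
    (Φ ^ n) (x : UnitAddCircle) = ((F ^ n) x : UnitAddCircle) := by
  induction n using Int.induction_on generalizing x with
  | zero => simp
  | succ n ih => rw [zpow_add_one, zpow_add_one, Homeomorph.mul_apply, Homeomorph.mul_apply, h, ih]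
  | pred n ih =>
    rw [zpow_sub_one, zpow_sub_one, Homeomorph.mul_apply, Homeomorph.mul_apply, ← ih]
    congr 1
    change Φ.symm _ = ((F.symm x : ℝ) : UnitAddCircle)
    rw [Φ.symm_apply_eq, h, F.apply_symm_apply]

lemma mem_iff_zpow_mem {F : ℝ ≃ₜ ℝ} {K : Set ℝ} (hK : ∀ z, F z ∈ K ↔ z ∈ K) (n : ℤ) (z : ℝ) :
    (F ^ n) z ∈ K ↔ z ∈ K := by
  induction n using Int.induction_on generalizing z with
  | zero => simp
  | succ n ih => rw [zpow_add_one, Homeomorph.mul_apply, ih, hK]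
  | pred n ih =>
    rw [zpow_sub_one, Homeomorph.mul_apply, ih]
    change F.symm z ∈ K ↔ _
    rw [← hK, F.apply_symm_apply]

lemma map_zpow_succ (F : ℝ ≃ₜ ℝ) (n : ℤ) (z : ℝ) : (F ^ (n + 1)) z = F ((F ^ n) z) := by
  rw [add_comm, zpow_one_add, Homeomorph.mul_apply]

/-! ### Trajectories, the return map and the suspended minimal set -/

namespace IsDisplacement

variable {ψ q : ℝ → ℝ} {ε : ℝ} (hd : IsDisplacement ψ q ε)

include hd

lemma exists_homeomorph : ∃ F : ℝ ≃ₜ ℝ, ∀ x, F x = x + ψ x := by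
  have hval : ∀ x, isotopy ψ (x, 1) = x + ψ x := fun x => by
    rw [isotopy, cutoff_eq_one (by norm_num), one_mul]
  refine ⟨(StrictMono.orderIsoOfSurjective (fun x => isotopy ψ (x, 1)) (hd.isotopy_strictMono 1)
    (hd.isotopy_surjective 1)).toHomeomorph, fun x => hval x⟩

omit hd in
lemma snd_trajectory {γ : ℝ → ℝ × ℝ} (hγ : IsTrajectory (torusField ψ) γ) (t : ℝ) :
    (γ t).2 = (γ 0).2 + t := by
  have h1 : ∀ t, HasDerivAt (fun t => (γ t).2 - t) 0 t := fun t => by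
    have := (hasFDerivAt_snd (𝕜 := ℝ) (p := γ t)).comp_hasDerivAt t (hγ t)
    simpa [Function.comp_def] using this.fun_sub (hasDerivAt_id' t)
  have := is_const_of_deriv_eq_zero (fun t => (h1 t).differentiableAt) (fun t => (h1 t).deriv) t 0
  linarith

/-- `label` is a first integral: its differential annihilates the field. This holds over the whole
enlarged window, where the periodized field is a vertical translate of `field`. -/
lemma label_trajectory {γ : ℝ → ℝ × ℝ} (hγ : IsTrajectory (torusField ψ) γ) {j : ℤ} {s t : ℝ}
    (hs : (γ s).2 ∈ Ioo ((j : ℝ) - 1 / 3) (j + 4 / 3))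
    (ht : (γ t).2 ∈ Ioo ((j : ℝ) - 1 / 3) (j + 4 / 3)) :
    label ψ ((γ s).1, (γ s).2 - j) = label ψ ((γ t).1, (γ t).2 - j) := by
  set c := (γ 0).2 with hc
  set I := Ioo ((j : ℝ) - 1 / 3 - c) (j + 4 / 3 - c) with hI
  have hmem : ∀ {t}, t ∈ I → (γ t).2 ∈ Ioo ((j : ℝ) - 1 / 3) (j + 4 / 3) := fun {t} h => by
    rw [snd_trajectory hγ]; exact ⟨by linarith [h.1], by linarith [h.2]⟩
  have hmem' : ∀ {t}, (γ t).2 ∈ Ioo ((j : ℝ) - 1 / 3) (j + 4 / 3) → t ∈ I := fun {t} h => by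
    rw [snd_trajectory hγ] at h; exact ⟨by linarith [h.1], by linarith [h.2]⟩
  have hder : ∀ t ∈ I, HasDerivAt (fun t => label ψ ((γ t).1, (γ t).2 - j)) 0 t := fun t ht => by
    have hJ := (hd.jacobian_pos (label ψ ((γ t).1, (γ t).2 - j)) ((γ t).2 - j)).ne'
    have h1 := (hasFDerivAt_fst (𝕜 := ℝ) (p := γ t)).comp_hasDerivAt t (hγ t)
    have h2 := (hasFDerivAt_snd (𝕜 := ℝ) (p := γ t)).comp_hasDerivAt t (hγ t)
    have h3 := (hd.hasFDerivAt_label ((γ t).1, (γ t).2 - j)).comp_hasDerivAt t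
      (h1.prodMk (h2.sub_const (j : ℝ)))
    refine h3.congr_deriv ?_
    rw [hd.torusLift_torusField, vanishesOffStrip_field.periodizeSnd_eq (hmem ht)]
    simp only [planeForm_apply, ContinuousLinearMap.coe_fst', ContinuousLinearMap.coe_snd', field]
    field_simp
    ring
  exact isOpen_Ioo.is_const_of_deriv_eq_zero isPreconnected_Ioo
    (fun t ht => (hder t ht).differentiableAt.differentiableWithinAt)
    (fun t ht => (hder t ht).deriv) (hmem' hs) (hmem' ht)

variable {F : ℝ ≃ₜ ℝ} (hF : ∀ x, F x = x + ψ x)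

omit hd in
/-- The trajectory through the point `(z, 0)`. -/
noncomputable def trajectory (ψ : ℝ → ℝ) (F : ℝ ≃ₜ ℝ) (z t : ℝ) : ℝ × ℝ :=
  (isotopy ψ ((F ^ ⌊t⌋) z, Int.fract t), t)

omit hd in
include hF in
lemma isotopy_of_ge {y : ℝ} (hy : 2 / 3 ≤ y) (z : ℝ) : isotopy ψ (z, y) = F z := by
  rw [isotopy, cutoff_eq_one hy, one_mul, hF]

omit hd in
lemma isotopy_of_le {y : ℝ} (hy : y ≤ 1 / 3) (z : ℝ) : isotopy ψ (z, y) = z := by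
  rw [isotopy, cutoff_eq_zero hy, zero_mul, add_zero]

omit hd in
include hF in
lemma trajectory_eq_of_mem_window (z : ℝ) {t : ℝ} {j : ℤ}
    (ht : t ∈ Ioo ((j : ℝ) - 1 / 3) (j + 4 / 3)) :
    trajectory ψ F z t = (isotopy ψ ((F ^ j) z, t - j), t) := by
  unfold trajectory
  rcases fract_cases_of_mem_window ht with ⟨h, -⟩ | ⟨h, h'⟩ | ⟨h, h'⟩
  · have : ⌊t⌋ = j := by rw [Int.fract] at h; exact_mod_cast (by linarith : (⌊t⌋ : ℝ) = j)
    rw [h, this]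
  · have : ⌊t⌋ = j - 1 := by
      rw [Int.fract] at h; exact_mod_cast (by linarith : (⌊t⌋ : ℝ) = j - 1)
    rw [h, this, isotopy_of_ge hF (by linarith [ht.1]), isotopy_of_le (by linarith),
      ← map_zpow_succ, sub_add_cancel]
  · have : ⌊t⌋ = j + 1 := by
      rw [Int.fract] at h; exact_mod_cast (by linarith : (⌊t⌋ : ℝ) = j + 1)
    rw [h, this, isotopy_of_le (by linarith [ht.2]), isotopy_of_ge hF (by linarith),
      ← map_zpow_succ]

include hF

lemma isTrajectory_trajectory (z : ℝ) : IsTrajectory (torusField ψ) (trajectory ψ F z) := by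
  intro t
  have h1 := Int.floor_le t
  have h2 := Int.lt_floor_add_one t
  have hev : trajectory ψ F z =ᶠ[𝓝 t] fun t' => (isotopy ψ ((F ^ ⌊t⌋) z, t' - ⌊t⌋), t') := by
    filter_upwards [Ioo_mem_nhds (show (⌊t⌋ : ℝ) - 1 / 3 < t by linarith)
      (show t < ⌊t⌋ + 4 / 3 by linarith)] with t' ht'
    exact trajectory_eq_of_mem_window hF z ht'
  have h3 := (hd.hasFDerivAt_isotopy ((F ^ ⌊t⌋) z, t - ⌊t⌋)).comp_hasDerivAt t
    ((hasDerivAt_const t ((F ^ ⌊t⌋) z)).prodMk ((hasDerivAt_id t).sub_const (⌊t⌋ : ℝ)))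
  refine ((h3.prodMk (hasDerivAt_id t)).congr_of_eventuallyEq hev).congr_deriv ?_
  rw [hd.torusLift_torusField]
  simp [periodizeSnd, field, trajectory, hd.label_isotopy]

lemma isReturnMap {Φ : UnitAddCircle ≃ₜ UnitAddCircle}
    (hΦ : ∀ x : ℝ, Φ (x : UnitAddCircle) = (F x : UnitAddCircle)) :
    IsReturnMap (torusField ψ) Φ := by
  intro γ hγ h0
  have h1 : (γ 1).2 = 1 := by rw [snd_trajectory hγ, h0, zero_add]
  have := hd.label_trajectory hγ (j := 0) (s := 1) (t := 0) (by rw [h1]; norm_num)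
    (by rw [h0]; norm_num)
  rw [h0, h1, hd.label_of_ge (by norm_num), hd.label_of_le (by norm_num)] at this
  rw [hΦ, hF]
  exact congrArg _ this

omit hd hF in
/-- The saturation by the flow of a set on the circle `y = 0`. -/
def suspension (ψ : ℝ → ℝ) (K : Set ℝ) : Set Torus :=
  {P | label ψ (circleRep P.1, circleRep P.2) ∈ K}

variable {K : Set ℝ} (hKF : ∀ z, F z ∈ K ↔ z ∈ K) (hK1 : ∀ (z : ℝ) (m : ℤ), z + m ∈ K ↔ z ∈ K)

include hK1

omit hF in
lemma mem_suspension_iff (p : ℝ × ℝ) :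
    torusProj p ∈ suspension ψ K ↔ label ψ (p.1, Int.fract p.2) ∈ K := by
  simp only [suspension, torusProj, mem_ofPred_eq, circleRep_coe]
  rw [← hK1 _ ⌊p.1⌋, ← hd.label_add_int, Int.fract_add_floor]

include hKF

/-- Crossing an integer height replaces the label by its image or preimage under `F`, which does not
affect membership in an `F`-invariant set. -/
lemma mem_suspension_iff_of_mem_window {p : ℝ × ℝ} {j : ℤ}
    (hp : p.2 ∈ Ioo ((j : ℝ) - 1 / 3) (j + 4 / 3)) :
    torusProj p ∈ suspension ψ K ↔ label ψ (p.1, p.2 - j) ∈ K := by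
  rw [hd.mem_suspension_iff hK1]
  rcases fract_cases_of_mem_window hp with ⟨h, -⟩ | ⟨h, h'⟩ | ⟨h, h'⟩
  · rw [h]
  · have h1 : F (label ψ (p.1, Int.fract p.2)) = p.1 := by
      rw [hF]
      exact (hd.label_of_ge (p := (p.1, Int.fract p.2)) (by rw [h]; linarith [hp.1])).1 rfl
    rw [← hKF, h1, hd.label_of_le (p := (p.1, p.2 - j)) (by simp only; linarith)]
  · have h1 : F (label ψ (p.1, p.2 - j)) = p.1 := by
      rw [hF]
      exact (hd.label_of_ge (p := (p.1, p.2 - j)) (by simp only; linarith)).1 rfl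
    rw [← hKF (label ψ (p.1, p.2 - j)), h1,
      hd.label_of_le (p := (p.1, Int.fract p.2)) (by rw [h]; linarith [hp.2])]

lemma isClosed_suspension (hK : IsClosed K) : IsClosed (suspension ψ K) := by
  rw [← isOpenQuotientMap_torusProj.isQuotientMap.isClosed_preimage, ← isOpen_compl_iff,
    isOpen_iff_mem_nhds]
  intro p hp
  have h1 := Int.floor_le p.2
  have h2 := Int.lt_floor_add_one p.2
  have hw : p.2 ∈ Ioo ((⌊p.2⌋ : ℝ) - 1 / 3) (⌊p.2⌋ + 4 / 3) := ⟨by linarith, by linarith⟩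
  have hc : Continuous fun p' : ℝ × ℝ => label ψ (p'.1, p'.2 - ⌊p.2⌋) :=
    hd.continuous_label.comp (by fun_prop)
  rw [mem_compl_iff, mem_preimage, hd.mem_suspension_iff_of_mem_window hF hKF hK1 hw] at hp
  filter_upwards [continuous_snd.continuousAt.preimage_mem_nhds (Ioo_mem_nhds hw.1 hw.2),
    hc.continuousAt.preimage_mem_nhds (hK.isOpen_compl.mem_nhds hp)] with p' hp1 hp2
  rw [mem_compl_iff, mem_preimage, hd.mem_suspension_iff_of_mem_window hF hKF hK1 hp1]
  exact hp2

lemma isFlowInvariant_suspension : IsFlowInvariant (torusField ψ) (suspension ψ K) := by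
  intro γ hγ s t h
  -- Conservation of the label makes membership locally constant in time, hence constant on the
  -- connected line.
  have hlc : IsLocallyConstant fun t => torusProj (γ t) ∈ suspension ψ K := by
    rw [IsLocallyConstant.iff_eventually_eq]
    intro t
    have h1 := Int.floor_le (γ t).2
    have h2 := Int.lt_floor_add_one (γ t).2
    have hw : (γ t).2 ∈ Ioo ((⌊(γ t).2⌋ : ℝ) - 1 / 3) (⌊(γ t).2⌋ + 4 / 3) :=
      ⟨by linarith, by linarith⟩
    have hc : ContinuousAt (fun t => (γ t).2) t := (hγ t).continuousAt.snd
    filter_upwards [hc.preimage_mem_nhds (Ioo_mem_nhds hw.1 hw.2)] with t' ht'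
    rw [hd.mem_suspension_iff_of_mem_window hF hKF hK1 hw,
      hd.mem_suspension_iff_of_mem_window hF hKF hK1 ht', hd.label_trajectory hγ ht' hw]
  rwa [hlc.apply_eq_of_preconnectedSpace t s]

/-- A nonempty closed invariant set contains the suspension of any set in the closure of every
orbit. -/
lemma suspension_subset (hdense : ∀ x₀, ∀ z ∈ K, ∀ δ > 0, ∃ n m : ℤ, |(F ^ n) x₀ + m - z| < δ)
    {S : Set Torus} (hne : S.Nonempty) (hcl : IsClosed S)
    (hinv : IsFlowInvariant (torusField ψ) S) : suspension ψ K ⊆ S := by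
  -- Every point lies on the trajectory of some `(z, 0)`: undo `⌊p.2⌋` iterates of `F` on its label.
  have hthrough : ∀ p : ℝ × ℝ,
      trajectory ψ F ((F ^ (-⌊p.2⌋)) (label ψ (p.1, Int.fract p.2))) p.2 = p := fun p => by
    unfold trajectory
    rw [← Homeomorph.mul_apply, ← zpow_add, add_neg_cancel, zpow_zero, Homeomorph.one_apply,
      hd.isotopy_label (p.1, Int.fract p.2)]
  have hint : ∀ (z : ℝ) (n : ℤ), trajectory ψ F z n = ((F ^ n) z, (n : ℝ)) := fun z n => by
    unfold trajectory
    rw [Int.floor_intCast, Int.fract_intCast, isotopy_of_le (by norm_num)]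
  obtain ⟨P, hP⟩ := hne
  obtain ⟨p, rfl⟩ := isOpenQuotientMap_torusProj.surjective P
  set z₀ := (F ^ (-⌊p.2⌋)) (label ψ (p.1, Int.fract p.2)) with hz₀
  have horb : ∀ n m : ℤ, torusProj ((F ^ n) z₀ + m, 0) ∈ S := fun n m => by
    have h1 := hinv _ (hd.isTrajectory_trajectory hF z₀) p.2 n (by rwa [hthrough])
    rw [hint, ← torusProj_add_int _ _ m (-n)] at h1
    convert h1 using 2
    push_cast; simp
  intro Q hQ
  obtain ⟨w, rfl⟩ := isOpenQuotientMap_torusProj.surjective Q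
  rw [hd.mem_suspension_iff hK1] at hQ
  set z := (F ^ (-⌊w.2⌋)) (label ψ (w.1, Int.fract w.2)) with hz
  have hzK : z ∈ K := (mem_iff_zpow_mem hKF _ _).2 hQ
  have hzS : torusProj (z, 0) ∈ S := by
    rw [← hcl.closure_eq, mem_closure_iff_nhds]
    intro V hV
    have hcont : Continuous fun x : ℝ => torusProj (x, 0) :=
      isOpenQuotientMap_torusProj.continuous.comp (by fun_prop)
    obtain ⟨δ, hδ, hball⟩ := Metric.mem_nhds_iff.1 (hcont.continuousAt.preimage_mem_nhds hV)
    obtain ⟨n, m, hnm⟩ := hdense z₀ z hzK δ hδ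
    exact ⟨_, hball (by rwa [Metric.mem_ball, Real.dist_eq]), horb n m⟩
  have h0 := hint z 0
  rw [Int.cast_zero, zpow_zero, Homeomorph.one_apply] at h0
  have := hinv _ (hd.isTrajectory_trajectory hF z) 0 w.2 (by rwa [h0])
  rwa [hthrough] at this

lemma isDenjoyContinuum_suspension
    (hdense : ∀ x₀, ∀ z ∈ K, ∀ δ > 0, ∃ n m : ℤ, |(F ^ n) x₀ + m - z| < δ)
    (hK : IsClosed K) (hne : K.Nonempty) :
    IsDenjoyContinuum (torusField ψ) (suspension ψ K) := by
  have hcl := hd.isClosed_suspension hF hKF hK1 hK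
  have hinv := hd.isFlowInvariant_suspension hF hKF hK1
  have hne' : (suspension ψ K).Nonempty := by
    obtain ⟨z, hz⟩ := hne
    refine ⟨torusProj (z, 0), ?_⟩
    rwa [hd.mem_suspension_iff hK1, Int.fract_zero, hd.label_of_le (by norm_num)]
  refine ⟨⟨hne', hcl, hinv, fun S' hsub hne hcl hinv => hsub.antisymm
    (hd.suspension_subset hF hKF hK1 hdense hne hcl hinv)⟩, fun D' hD' => ?_⟩
  exact (hD'.2.2.2 _ (hd.suspension_subset hF hKF hK1 hdense hD'.1 hD'.2.1 hD'.2.2.1)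
    hne' hcl hinv).symm

omit hF hKF in
lemma partialX_eq_zero_of_mem_suspension (hq : ∀ z ∈ K, q z = 0) {x y : ℝ}
    (h : torusProj (x, y) ∈ suspension ψ K) : partialX (torusField ψ) x y = 0 := by
  rw [hd.mem_suspension_iff hK1] at h
  rw [hd.partialX_torusField, periodizeSnd, fieldX, hq _ h]
  simp

end IsDisplacement

/-! ### Dynamics of the Denjoy map -/

namespace IsGapSeq

variable {l : ℤ → ℝ} (hl : IsGapSeq l) {θ : ℝ} (hθ : Irrational θ)

lemma isClosed_gapCompl : IsClosed (gapCompl l θ) := by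
  have : gapCompl l θ = ⋂ (n : ℤ) (m : ℤ),
      (Ioo (leftEnd l θ n + m) (leftEnd l θ n + m + l n))ᶜ := by
    ext z; simp only [gapCompl, mem_iInter, mem_compl_iff]; rfl
  rw [this]
  exact isClosed_iInter fun n => isClosed_iInter fun m => isOpen_Ioo.isClosed_compl

lemma add_int_mem_gapCompl (z : ℝ) (k : ℤ) : z + k ∈ gapCompl l θ ↔ z ∈ gapCompl l θ := by
  constructor
  · intro h n m hz
    refine h n (m + k) ?_
    push_cast
    exact ⟨by linarith [hz.1], by linarith [hz.2]⟩
  · intro h n m hz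
    refine h n (m - k) ?_
    push_cast
    exact ⟨by linarith [hz.1], by linarith [hz.2]⟩

include hl hθ

omit hl hθ in
lemma jumpR_add_int (s : ℝ) (m : ℤ) : jumpR l θ (s + m) = jumpR l θ s + m := by
  have : ∀ n : ℤ, (⌊s + m - n * θ⌋ : ℝ) + 1 - (s + m - n * θ) = ⌊s - n * θ⌋ + 1 - (s - n * θ) :=
    fun n => by
      rw [show s + m - n * θ = s - n * θ + m by ring, Int.floor_add_intCast]; push_cast; ring
  simp only [jumpR, this]; ring

variable {F : ℝ ≃ₜ ℝ} (hFX : ∀ s, F (jumpL l θ s) = jumpL l θ (s + θ))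

omit hθ in
lemma tendsto_jumpL_right (s : ℝ) : Tendsto (jumpL l θ) (𝓝[>] s) (𝓝 (jumpR l θ s)) := by
  have h1 : Tendsto (jumpR l θ) (𝓝[>] s) (𝓝 (jumpR l θ s)) :=
    (hl.tendsto_jumpR s).mono_left (nhdsWithin_mono _ Ioi_subset_Ici_self)
  refine tendsto_of_tendsto_of_tendsto_of_le_of_le' tendsto_const_nhds h1 ?_
    (Eventually.of_forall fun s' => hl.jumpL_le_jumpR s')
  filter_upwards [self_mem_nhdsWithin] with s' hs'
  exact (hl.jumpR_lt_jumpL (mem_Ioi.1 hs')).le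

include hFX

omit hθ in
lemma map_jumpR (s : ℝ) : F (jumpR l θ s) = jumpR l θ (s + θ) := by
  have h1 : Tendsto (fun s' => F (jumpL l θ s')) (𝓝[>] s) (𝓝 (F (jumpR l θ s))) :=
    (F.continuous.tendsto _).comp (hl.tendsto_jumpL_right s)
  have h2 : Tendsto (fun s' => s' + θ) (𝓝[>] s) (𝓝[>] (s + θ)) := by
    refine tendsto_nhdsWithin_iff.2 ⟨((continuous_add_const θ).tendsto s).mono_left
      nhdsWithin_le_nhds, ?_⟩
    filter_upwards [self_mem_nhdsWithin] with x hx
    exact mem_Ioi.2 (add_lt_add_left (mem_Ioi.1 hx) _)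
  have h3 := (hl.tendsto_jumpL_right (θ := θ) (s + θ)).comp h2
  refine tendsto_nhds_unique h1 (h3.congr fun s' => ?_)
  exact (hFX s').symm

omit hl hθ hFX in
lemma zpow_map_jump {J : ℝ → ℝ} (hJ : ∀ s, F (J s) = J (s + θ)) (n : ℤ) (s : ℝ) :
    (F ^ n) (J s) = J (s + n * θ) := by
  induction n using Int.induction_on with
  | zero => simp
  | succ n ih => rw [map_zpow_succ, ih, hJ]; push_cast; ring_nf
  | pred n ih =>
    apply F.injective
    rw [← map_zpow_succ, sub_add_cancel, ih, hJ]; push_cast; ring_nf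

variable (hFm : StrictMono F)

lemma map_gap_ends (n m : ℤ) : F (leftEnd l θ n + m) = leftEnd l θ (n + 1) + m ∧
    F (leftEnd l θ n + m + l n) = leftEnd l θ (n + 1) + m + l (n + 1) := by
  constructor
  · rw [leftEnd_add, leftEnd_add, hFX]; push_cast; ring_nf
  · rw [← hl.jumpR_orbit hθ, ← hl.jumpR_orbit hθ, hl.map_jumpR hFX]; push_cast; ring_nf

include hFm

lemma map_mem_gap_iff (z : ℝ) (n m : ℤ) :
    F z ∈ Ioo (leftEnd l θ (n + 1) + m) (leftEnd l θ (n + 1) + m + l (n + 1)) ↔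
      z ∈ Ioo (leftEnd l θ n + m) (leftEnd l θ n + m + l n) := by
  obtain ⟨h1, h2⟩ := hl.map_gap_ends hθ hFX n m
  rw [← h2, ← h1, mem_Ioo, mem_Ioo, hFm.lt_iff_lt, hFm.lt_iff_lt]

lemma zpow_map_mem_gap_iff (z : ℝ) (k n m : ℤ) :
    (F ^ k) z ∈ Ioo (leftEnd l θ (n + k) + m) (leftEnd l θ (n + k) + m + l (n + k)) ↔
      z ∈ Ioo (leftEnd l θ n + m) (leftEnd l θ n + m + l n) := by
  induction k using Int.induction_on with
  | zero => simp
  | succ k ih =>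
    rw [map_zpow_succ, ← add_assoc, hl.map_mem_gap_iff hθ hFX hFm, ih]
  | pred k ih =>
    rw [← ih, ← hl.map_mem_gap_iff hθ hFX hFm, ← map_zpow_succ, sub_add_cancel,
      show n + (-(k:ℤ) - 1) + 1 = n + -(k:ℤ) by ring]

lemma map_mem_gapCompl_iff (z : ℝ) : F z ∈ gapCompl l θ ↔ z ∈ gapCompl l θ := by
  constructor
  · intro h n m hz
    exact h (n + 1) m ((hl.map_mem_gap_iff hθ hFX hFm z n m).2 hz)
  · intro h n m hz
    refine h (n - 1) m ((hl.map_mem_gap_iff hθ hFX hFm z (n - 1) m).1 ?_)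
    rwa [sub_add_cancel]

omit hFm hθ hl hFX in
lemma strictMono_zpow (hFm : StrictMono F) (n : ℤ) : StrictMono (F ^ n : ℝ ≃ₜ ℝ) := by
  induction n using Int.induction_on with
  | zero => exact strictMono_id
  | succ n ih => rw [zpow_add_one]; exact ih.comp hFm
  | pred n ih =>
    rw [zpow_sub_one]
    refine ih.comp fun x y hxy => ?_
    change F.symm x < F.symm y
    rwa [← hFm.lt_iff_lt, F.apply_symm_apply, F.apply_symm_apply]

/-- Every orbit accumulates at every point of the Cantor set. -/
lemma exists_orbit_near (x₀ : ℝ) {z : ℝ} (hz : z ∈ gapCompl l θ) {δ : ℝ} (hδ : 0 < δ) :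
    ∃ n m : ℤ, |(F ^ n) x₀ + m - z| < δ := by
  obtain ⟨s₀, h1, h2⟩ := hl.exists_between_jump (θ := θ) x₀
  -- Monotonicity of `F ^ n` keeps the orbit squeezed between the one-sided values at the rotated
  -- parameter.
  have hb : ∀ n m : ℤ, jumpL l θ (s₀ + n * θ + m) ≤ (F ^ n) x₀ + m ∧
      (F ^ n) x₀ + m ≤ jumpR l θ (s₀ + n * θ + m) := fun n m => by
    have hm := (strictMono_zpow hFm n).monotone
    have h1' := hm h1
    have h2' := hm h2
    rw [zpow_map_jump hFX] at h1'
    rw [zpow_map_jump (hl.map_jumpR hFX)] at h2'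
    rw [jumpL_add_int, jumpR_add_int]
    exact ⟨by linarith, by linarith⟩
  obtain ⟨s, rfl | rfl⟩ := hl.exists_jump_eq hθ hz
  · have hev := (hl.tendsto_jumpL (θ := θ) s).eventually
      (lt_mem_nhds (show jumpL l θ s - δ < jumpL l θ s by linarith))
    obtain ⟨s', hs', hsub⟩ := (mem_nhdsLE_iff_exists_Ioc_subset).1 hev
    -- The parameter lies strictly left of `s`, so even the right value there stays below `jumpL l θ
    -- s`; left continuity bounds the left value from below.
    obtain ⟨n, m, hnm⟩ := exists_orbit_mem_Ioo hθ s₀ (mem_Iio.1 hs')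
    have h3 : jumpL l θ s - δ < jumpL l θ (s₀ + n * θ + m) := hsub ⟨hnm.1, hnm.2.le⟩
    have h4 := hl.jumpR_lt_jumpL (θ := θ) hnm.2
    refine ⟨n, m, ?_⟩
    rw [abs_lt]
    constructor <;> linarith [(hb n m).1, (hb n m).2]
  · have hev := (hl.tendsto_jumpR (θ := θ) s).eventually
      (gt_mem_nhds (show jumpR l θ s < jumpR l θ s + δ by linarith))
    obtain ⟨s', hs', hsub⟩ := (mem_nhdsGE_iff_exists_Ico_subset).1 hev
    obtain ⟨n, m, hnm⟩ := exists_orbit_mem_Ioo hθ s₀ (mem_Ioi.1 hs')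
    have h3 : jumpR l θ (s₀ + n * θ + m) < jumpR l θ s + δ := hsub ⟨hnm.1.le, hnm.2⟩
    have h4 := hl.jumpR_lt_jumpL (θ := θ) hnm.1
    refine ⟨n, m, ?_⟩
    rw [abs_lt]
    constructor <;> linarith [(hb n m).1, (hb n m).2]

/-- For every orbit there is an open interval that its lifts avoid. -/
lemma exists_interval_avoiding_orbit (x₀ : ℝ) :
    ∃ u v : ℝ, u < v ∧ ∀ n m : ℤ, (F ^ n) x₀ + m ∉ Ioo u v := by
  by_cases hx : x₀ ∈ gapCompl l θ
  -- An orbit in the Cantor set meets no gap, so any gap serves.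
  · refine ⟨leftEnd l θ 0 + (0 : ℤ), leftEnd l θ 0 + (0 : ℤ) + l 0, by linarith [hl.pos 0],
      fun n m => ?_⟩
    have h1 := (mem_iff_zpow_mem (hl.map_mem_gapCompl_iff hθ hFX hFm) n x₀).2 hx
    exact (add_int_mem_gapCompl _ m).2 h1 0 0
  · have hx' : ∃ n m : ℤ, x₀ ∈ Ioo (leftEnd l θ n + m) (leftEnd l θ n + m + l n) := by
      by_contra! h; exact hx h
    obtain ⟨n, m, hnm⟩ := hx'
    -- The orbit of a point in a gap visits that lifted gap only at the point itself, so the open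
    -- piece to its left is avoided.
    refine ⟨leftEnd l θ n + m, x₀, hnm.1, fun k j hk => ?_⟩
    have h1 := (hl.zpow_map_mem_gap_iff hθ hFX hFm x₀ k n m).2 hnm
    have h2 : (F ^ k) x₀ + j ∈ Icc (leftEnd l θ (n + k) + (m + j : ℤ))
        (leftEnd l θ (n + k) + (m + j : ℤ) + l (n + k)) := by
      push_cast; constructor <;> linarith [h1.1, h1.2]
    obtain ⟨h3, h4⟩ := hl.eq_of_mem_gaps hθ h2 (n' := n) (m' := m)
      ⟨hk.1.le, (hk.2.trans hnm.2).le⟩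
    have hk0 : k = 0 := by omega
    have hj0 : j = 0 := by omega
    subst hk0 hj0
    simp at hk

variable {Φ : UnitAddCircle ≃ₜ UnitAddCircle}
  (hΦ : ∀ x : ℝ, Φ (x : UnitAddCircle) = (F x : UnitAddCircle)) (hF1 : ∀ x, F (x + 1) = F x + 1)

include hΦ

include hF1 in
lemma isDenjoyMap : IsDenjoyMap Φ := by
  refine ⟨⟨⟨⟨F, hFm.monotone⟩, hF1⟩, fun x => (hΦ x).symm, ?_⟩, fun P hdense => ?_⟩
  -- Equality of translation numbers needs only a monotone degree one semiconjugacy, so the jumps of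
  -- `jumpL` do no harm.
  · let X : CircleDeg1Lift := ⟨⟨jumpL l θ, hl.jumpL_strictMono.monotone⟩, fun s => by
      simpa using jumpL_add_int (l := l) (θ := θ) s 1⟩
    rw [← CircleDeg1Lift.translationNumber_eq_of_semiconj
      (f := X) (g₁ := ↑(CircleDeg1Lift.translate (Multiplicative.ofAdd θ))) fun s => ?_,
      CircleDeg1Lift.translationNumber_translate]
    · exact hθ
    · change jumpL l θ (θ + s) = F (jumpL l θ s)
      rw [hFX, add_comm]
  · obtain ⟨x₀, rfl⟩ := QuotientAddGroup.mk_surjective P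
    obtain ⟨u, v, huv, h⟩ := hl.exists_interval_avoiding_orbit hθ hFX hFm x₀
    have hopen : IsOpen ((fun x : ℝ => (x : UnitAddCircle)) '' Ioo u v) :=
      QuotientAddGroup.isOpenQuotientMap_mk.isOpenMap _ isOpen_Ioo
    obtain ⟨Q, ⟨x, hx, rfl⟩, n, hn⟩ := hdense.inter_open_nonempty _ hopen
      ((nonempty_Ioo.2 huv).image _)
    have hn' : (((F ^ n) x₀ : ℝ) : UnitAddCircle) = (x : UnitAddCircle) :=
      (circle_homeomorph_zpow hΦ n x₀).symm.trans hn
    obtain ⟨m, rfl⟩ := circle_coe_eq_iff.1 hn'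
    exact h n m hx

lemma isBuiltFromArcs {K : Set UnitAddCircle}
    (hK : ∀ x : ℝ, (x : UnitAddCircle) ∈ K ↔ x ∈ gapCompl l θ) : IsBuiltFromArcs Φ K l := by
  refine ⟨leftEnd l θ, fun m n hmn => ?_, fun n => ?_, ?_⟩
  · rw [Set.disjoint_left]
    rintro P ⟨x, hx, rfl⟩ ⟨y, hy, hxy⟩
    obtain ⟨k, rfl⟩ := circle_coe_eq_iff.1 hxy
    refine hmn (hl.eq_of_mem_gaps hθ (n := m) (m := 0) (n' := n) (m' := k) (x := y + k) ?_ ?_).1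
    · simpa using hx
    · exact ⟨by linarith [hy.1], by linarith [hy.2]⟩
  · obtain ⟨h1, h2⟩ := hl.map_gap_ends hθ hFX n 0
    simp only [Int.cast_zero, add_zero] at h1 h2
    unfold closedArc
    rw [← h2, ← h1, Set.image_image]
    ext P
    constructor
    · rintro ⟨x, hx, rfl⟩
      exact ⟨F x, ⟨hFm.monotone hx.1, hFm.monotone hx.2⟩, (hΦ x).symm⟩
    · rintro ⟨y, hy, rfl⟩
      obtain ⟨x, rfl⟩ := F.surjective y
      exact ⟨x, ⟨hFm.le_iff_le.1 hy.1, hFm.le_iff_le.1 hy.2⟩, hΦ x⟩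
  · ext P
    obtain ⟨x, rfl⟩ := QuotientAddGroup.mk_surjective P
    refine (hK x).trans ?_
    rw [mem_compl_iff, mem_iUnion, not_exists]
    constructor
    · rintro h n ⟨y, hy, hxy⟩
      obtain ⟨k, rfl⟩ := circle_coe_eq_iff.1 hxy
      exact h n k ⟨by linarith [hy.1], by linarith [hy.2]⟩
    · intro h n m hx
      exact h n ⟨x - m, ⟨by linarith [hx.1], by linarith [hx.2]⟩,
        circle_coe_eq_iff.2 ⟨m, by ring⟩⟩

end IsGapSeq

/-! ### Assembly for the prescribed lengths -/

lemma isGapSeq_arcLength {β k : ℝ} (hβ0 : 0 < β) (hβ1 : β < 1) (hk : 0 < k)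
    (hsum : ∑' n : ℤ, arcLength β k n < 1) : IsGapSeq (arcLength β k) where
  pos := arcLength_pos hk
  summable := summable_arcLength k hβ0 hβ1
  tsum_lt := hsum
  tendsto _ _ hα1 := tendsto_relIncr_arcLength hk hβ0 hβ1 hα1
  lower := ⟨2 / 3 * (1 / 2 : ℝ) ^ (1 / β), by positivity,
    fun n => (relIncr_arcLength_bounds hk hβ0 hβ1 n).1⟩

theorem mainTheorem5 (β : ℝ) (hβ0 : 0 < β) (hβ1 : β < 1) :
    ∃ k : ℝ, 0 < k ∧ Summable (arcLength β k) ∧ ∑' n : ℤ, arcLength β k n < 1 ∧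
      ∃ (h : Torus → ℝ) (Φ : UnitAddCircle ≃ₜ UnitAddCircle) (D : Set Torus),
        IsDenjoyField h ∧
        IsReturnMap h Φ ∧
        IsDenjoyContinuum h D ∧
        IsBuiltFromArcs Φ {x : UnitAddCircle | (x, (0 : UnitAddCircle)) ∈ D} (arcLength β k) ∧
        (∀ α : ℝ≥0, 0 < α → α < 1 → IsC1Holder h α) ∧
        (∀ x y : ℝ, torusProj (x, y) ∈ D → partialX h x y = 0) ∧
        ContDiff ℝ 2 (fun p : ℝ × ℝ => ∫ ξ in (0 : ℝ)..p.1, (partialX h ξ p.2) ^ 2) := by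
  obtain ⟨k, hk, hsum⟩ := exists_arcLength_tsum_eq_half hβ0 hβ1
  have hlt : ∑' n : ℤ, arcLength β k n < 1 := by rw [hsum]; norm_num
  refine ⟨k, hk, summable_arcLength k hβ0 hβ1, hlt, ?_⟩
  have hl := isGapSeq_arcLength hβ0 hβ1 hk hlt
  set l := arcLength β k
  -- Any irrational rotation number would serve.
  have hθ := irrational_sqrt_two
  set θ := √2
  obtain ⟨ψ, q, ε, hd, hq, hX⟩ := hl.exists_isDisplacement hθ
  obtain ⟨F, hF⟩ := hd.exists_homeomorph
  have hFX : ∀ s, F (IsGapSeq.jumpL l θ s) = IsGapSeq.jumpL l θ (s + θ) := fun s => by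
    rw [hF, hX]
  have hF1 : ∀ x, F (x + 1) = F x + 1 := fun x => by rw [hF, hF, hd.periodic]; ring
  have hFm : StrictMono F := by
    have := hd.isotopy_strictMono 1
    intro x y hxy
    rw [← IsDisplacement.isotopy_of_ge hF (y := 1) (by norm_num),
      ← IsDisplacement.isotopy_of_ge hF (y := 1) (by norm_num)]
    exact this hxy
  obtain ⟨Φ, hΦ⟩ := exists_circle_homeomorph F hF1
  have hK1 := IsGapSeq.add_int_mem_gapCompl (l := l) (θ := θ)
  have hKF := hl.map_mem_gapCompl_iff hθ hFX hFm
  have hret := hd.isReturnMap hF hΦ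
  refine ⟨IsDisplacement.torusField ψ, Φ, IsDisplacement.suspension ψ (IsGapSeq.gapCompl l θ),
    ⟨hd.contDiff_torusField, Φ, hret, hl.isDenjoyMap hθ hFX hFm hΦ hF1⟩, hret,
    hd.isDenjoyContinuum_suspension hF hKF hK1
      (fun x₀ z hz δ hδ => hl.exists_orbit_near hθ hFX hFm x₀ hz hδ) IsGapSeq.isClosed_gapCompl
      ⟨_, hl.jumpL_mem_gapCompl hθ 0⟩,
    hl.isBuiltFromArcs hθ hFX hFm hΦ fun x => ?_,
    fun α hα0 hα1 => hd.isC1Holder_torusField hα0 hα1,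
    fun x y h => hd.partialX_eq_zero_of_mem_suspension hK1 hq h,
    hd.contDiff_integral_partialX_sq⟩
  -- At height 0 the label is the point itself, so the trace of the suspension on `y = 0` is the
  -- Cantor set.
  have h := hd.mem_suspension_iff hK1 (x, 0)
  rw [Int.fract_zero, hd.label_of_le (by norm_num)] at h
  exact h
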